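/- Let $k$ be a field and $A$ a commutative $k$-algebra. For $n\ge 0$ let $C^n=C^n_{S^2}(A,A)=\mathrm{Hom}_k(A^{\otimes n(n-1)/2},A)$. The tensor factors are indexed by the positions $(p,q)$, $1\le p<q\le n$, above the diagonal of an $n\times n$ matrix, and a pure tensor is written as a tensor matrix $T=\otimes(a_{p,q})_{1\le p<q\le n}$ with $1$'s on the diagonal. Write $|f|=n-1$ for $f\in C^n$. *Differential.* Let $S^2$ have the simplicial structure whose points in degree $n$ are a base point $*$ and the symbols ${}^a\Delta^b_c$ with $a,b,c\ge 0$, $a+b+c=n-2$; identify ${}^a\Delta^b_c$ with the position $(a+1,a+b+2)$. The face $d_i$ fixes $*$; it lowers $a$ by one if $0\le i\le a$, lowers $b$ by one if $a+1\le i\le a+b+1$, and lowers $c$ by one if $a+b+2\le i\le n$, and it sends ${}^a\Delta^b_c$ to $*$ if the number to be lowered is $0$. The differential of higher order Hochschild cohomology is $\delta^{S^2}_n=\sum_{i=0}^{n+1}(-1)^i(d_i)^*:C^n\to C^{n+1}$, where $((d_i)^*f)(\otimes(a_v))=b_*\,f(\otimes (b_w))$, with $b_w=\prod_{d_i(v)=w}a_v$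 and $b_*=\prod_{d_i(v)=*}a_v$, $v$ running over the positions other than $*$. Put $H^n_{S^2}(A,A)=\ker\delta^{S^2}_n/\mathrm{im}\,\delta^{S^2}_{n-1}$ (with $\mathrm{im}\,\delta^{S^2}_{-1}=0$). *Operad.* For $f\in C^n$, $g\in C^m$ and $1\le i\le n$ let $f\circ_i g\in C^{n+m-1}$ be given by $(f\circ_i g)(T)=f(T')\,g(T'')$, where $T''$ is the $m\times m$ triangle of $T$ on the indices $i,\dots,i+m-1$, and $T'$ is the $n\times n$ tensor matrix obtained from $T$ by deleting this triangle and multiplying the columns $i,\dots,i+m-1$ together above it and the rows $i,\dots,i+m-1$ together to the right of it (for $m=0$ these empty products are $1$). Let $$f\circ g=\sum_{i=1}^n(-1)^{(i-1)(m-1)}f\circ_i g,\qquad [f,g]=f\circ g-(-1)^{(n-1)(m-1)}g\circ f .$$ Let $\mathfrak m\in C^2$ be given by $\mathfrak m\begin{pmatrix}1&a\\&1\end{pmatrix}=a$, let $d(f)=\mathfrak m\circ f-(-1)^{n-1}f\circ\mathfrak m$ for $f\in C^n$, and for $f\in C^n$, $g\in C^m$ let $$f\cdot g=(-1)^{|f|+1}\mathfrak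 m\{f,g\}\in C^{n+m},\qquad \mathfrak m\{f,g\}=(-1)^{(m-1)n}(\mathfrak m\circ_2 g)\circ_1 f .$$ **Theorem.** (i) For all $n\ge 0$ and $f\in C^n$, $\delta^{S^2}_n(f)=(-1)^{n-1}d(f)$; moreover $\delta^{S^2}_{n+1}\delta^{S^2}_n=0$. (ii) If $f\in C^p$ and $g\in C^q$ are cocycles, then $f\cdot g$ is a cocycle, and so is $[f,g]$ if $p+q\ge 1$. On $H^*_{S^2}(A,A)=\bigoplus_{n\ge0}H^n_{S^2}(A,A)$ there are $k$-bilinear operations, a cup product of degree $0$ and a bracket of degree $-1$ (so that the bracket is zero on $H^0\times H^0$), that are induced by these: the cup product of the classes of $f$ and $g$ is the class of $f\cdot g$, and their bracket is the class of $[f,g]$. They make $H^*_{S^2}(A,A)$ a $G$-algebra (Gerstenhaber algebra): for $x\in H^p$, $y\in H^q$ and all $z$, $$(x\cdot y)\cdot z=x\cdot(y\cdot z)\ \text{(this for all }x,y,z),\qquad x\cdot y=(-1)^{pq}\,y\cdot x,$$ $$[x,y]=-(-1)^{(p-1)(q-1)}[y,x],\qquad [x,[y,z]]=[[x,y],z]+(-1)^{(p-1)(q-1)}[y,[x,z]],$$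 $$[x,y\cdot z]=[x,y]\cdot z+(-1)^{(p-1)q}\,y\cdot[x,z].$$ -/

import Mathlib

open scoped DirectSum

namespace HigherHochschildS2

/-! ### Pulling multilinear maps back along maps of finite index sets -/

section Pullback

variable {k A V W : Type*} [CommRing k] [CommRing A] [Algebra k A]
  [Fintype V] [DecidableEq W]

theorem fiberProd_update [DecidableEq V] (φ : V → W) (a : V → A) (v₀ : V) (x : A) :
    (fun w => ∏ v with φ v = w, Function.update a v₀ x v) =
      Function.update (fun w => ∏ v with φ v = w, a v) (φ v₀)
        (x * ∏ v ∈ (Finset.univ.filter (fun v => φ v = φ v₀)).erase v₀, a v) := by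
  funext w
  by_cases hw : w = φ v₀
  · subst hw
    rw [Function.update_self,
      ← Finset.mul_prod_erase (Finset.univ.filter (fun v => φ v = φ v₀)) _
        (Finset.mem_filter.2 ⟨Finset.mem_univ v₀, rfl⟩), Function.update_self]
    congr 1
    refine Finset.prod_congr rfl fun v hv => ?_
    rw [Function.update_of_ne (Finset.ne_of_mem_erase hv)]
  · rw [Function.update_of_ne hw]
    refine Finset.prod_congr rfl fun v hv => ?_
    rw [Function.update_of_ne]
    rintro rfl
    exact hw (Finset.mem_filter.1 hv).2.symm

/-- `(pull φ f)(a) = f(b)`, where `b w` is the product of the `a v` with `φ v = w`. -/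
def pull (φ : V → W) (f : MultilinearMap k (fun _ : W => A) A) :
    MultilinearMap k (fun _ : V => A) A where
  toFun a := f fun w => ∏ v with φ v = w, a v
  map_update_add' a v x y := by
    rw [fiberProd_update, fiberProd_update, fiberProd_update, add_mul, f.map_update_add]
  map_update_smul' a v c x := by
    rw [fiberProd_update, fiberProd_update, smul_mul_assoc, f.map_update_smul]

theorem pull_apply (φ : V → W) (f : MultilinearMap k (fun _ : W => A) A) (a : V → A) :
    pull φ f a = f fun w => ∏ v with φ v = w, a v := rfl

/-- `f` with one more argument, by which its value is multiplied. -/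
def withCoeff (f : MultilinearMap k (fun _ : W => A) A) :
    MultilinearMap k (fun _ : Option W => A) A where
  toFun b := b none * f fun w => b (some w)
  map_update_add' b o x y := by
    have hd : ∀ (w : W) (z : A), (fun u => Function.update b (some w) z (some u)) =
        Function.update (fun u => b (some u)) w z := by
      intro w z
      funext u
      by_cases h : u = w
      · subst h; simp
      · simp [Function.update_of_ne, h]
    cases o with
    | none => simp [add_mul]
    | some w =>
      have h := fun z => hd w z
      convert_to b none * f (fun u => Function.update b (some w) (x + y) (some u)) =
        b none * f (fun u => Function.update b (some w) x (some u)) +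
        b none * f (fun u => Function.update b (some w) y (some u))
      · congr 1; simp
      · congr 1 <;> congr 1 <;> simp
      · rw [h, h, h, f.map_update_add, mul_add]
  map_update_smul' b o c x := by
    have hd : ∀ (w : W) (z : A), (fun u => Function.update b (some w) z (some u)) =
        Function.update (fun u => b (some u)) w z := by
      intro w z
      funext u
      by_cases h : u = w
      · subst h; simp
      · simp [Function.update_of_ne, h]
    cases o with
    | none => simp
    | some w =>
      have h := fun z => hd w z
      convert_to b none * f (fun u => Function.update b (some w) (c • x) (some u)) =
        c • (b none * f (fun u => Function.update b (some w) x (some u)))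
      · congr 1; simp
      · congr 2; simp
      · rw [h, h, f.map_update_smul, mul_smul_comm]

/-- The map induced on `Hom(A^{⊗ W}, A)` by a map `V ∪ {*} → W ∪ {*}` of finite pointed sets
(given by its restriction `φ` to the points of `V`, with `none` in the role of `*`):
`(φ^* f)(a) = b₀ f(b)`, where `b w` is the product of the `a v` with `φ v = w`, and `b₀` is the
product of the `a v` with `φ v = *`. -/
def pointedPull (φ : V → Option W) :
    MultilinearMap k (fun _ : W => A) A →ₗ[k] MultilinearMap k (fun _ : V => A) A where
  toFun f := pull φ (withCoeff f)
  map_add' f g := by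
    ext a
    simp [pull, withCoeff, mul_add]
  map_smul' c f := by
    ext a
    simp [pull, withCoeff]

theorem pointedPull_apply (φ : V → Option W) (f : MultilinearMap k (fun _ : W => A) A)
    (a : V → A) :
    pointedPull φ f a =
      (∏ v with φ v = none, a v) * f fun w => ∏ v with φ v = some w, a v := rfl

/-- The product of two multilinear maps, in the union of their arguments. -/
def sumMul {V₁ V₂ : Type*} (f : MultilinearMap k (fun _ : V₁ => A) A)
    (g : MultilinearMap k (fun _ : V₂ => A) A) :
    MultilinearMap k (fun _ : V₁ ⊕ V₂ => A) A :=
  (LinearMap.mul' k A).compMultilinearMap (MultilinearMap.domCoprod f g)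

theorem sumMul_apply {V₁ V₂ : Type*} (f : MultilinearMap k (fun _ : V₁ => A) A)
    (g : MultilinearMap k (fun _ : V₂ => A) A) (a : V₁ ⊕ V₂ → A) :
    sumMul f g a = f (fun v => a (Sum.inl v)) * g (fun v => a (Sum.inr v)) := by
  simp [sumMul]

end Pullback

/-! ### Subquotients -/

section Subquotient

variable {k M : Type*} [Ring k] [AddCommGroup M] [Module k M] (Z B : Submodule k M)

/-- The quotient of a submodule `Z` by `B` (which is contained in `Z` when this is used). -/
def Subquotient : Type _ := Z ⧸ B.submoduleOf Z

instance : AddCommGroup (Subquotient Z B) := inferInstanceAs (AddCommGroup (Z ⧸ B.submoduleOf Z))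

instance : Module k (Subquotient Z B) := inferInstanceAs (Module k (Z ⧸ B.submoduleOf Z))

/-- The projection of `Z` onto the subquotient. -/
def Subquotient.mk : Z →ₗ[k] Subquotient Z B := (B.submoduleOf Z).mkQ

end Subquotient

/-! ### The cochains and the differential -/

/-- The positions above the diagonal of an `n × n` matrix, with rows and columns counted from `0`.
They are the points other than the base point in degree `n` of the simplicial set `S²`; the point
`^aΔ^b_c` (where `a + b + c = n - 2`) is the position `(a, a + b + 1)`. -/
abbrev Pos (n : ℕ) : Type := {v : Fin n × Fin n // v.1 < v.2}

/-- The face `d_i` of the simplicial set `S²` on the points other than the base point; `none` is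
the base point. For `v = ^aΔ^b_c` the three cases are `i ≤ a`, `a < i ≤ a + b + 1` and
`a + b + 2 ≤ i`, where `d_i` lowers respectively `a`, `b` and `c` by one, and gives the base point
if that number is `0`. -/
def face (n : ℕ) (i : Fin (n + 2)) (v : Pos (n + 1)) : Option (Pos n) :=
  if h₁ : (i : ℕ) ≤ v.1.1 then
    if h : (v.1.1 : ℕ) = 0 then none
    else some ⟨(⟨(v.1.1 : ℕ) - 1, by omega⟩, ⟨(v.1.2 : ℕ) - 1, by omega⟩), by
      have := v.2
      simp only [Fin.lt_def] at this ⊢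
      omega⟩
  else if h₂ : (i : ℕ) ≤ v.1.2 then
    if h : (v.1.2 : ℕ) = v.1.1 + 1 then none
    else some ⟨(⟨(v.1.1 : ℕ), by have := v.2; simp only [Fin.lt_def] at this; omega⟩,
        ⟨(v.1.2 : ℕ) - 1, by omega⟩), by
      have := v.2
      simp only [Fin.lt_def] at this ⊢
      omega⟩
  else
    if h : (v.1.2 : ℕ) = n then none
    else some ⟨(⟨(v.1.1 : ℕ), by have := v.2; simp only [Fin.lt_def] at this; omega⟩,
        ⟨(v.1.2 : ℕ), by omega⟩), v.2⟩

section Cochains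

variable (k A : Type*) [CommRing k] [CommRing A] [Algebra k A]

/-- `C^n_{S²}(A, A) = Hom_k(A^{⊗ n(n-1)/2}, A)`; the arguments are the entries of a tensor matrix. -/
abbrev Cochain (n : ℕ) : Type _ := MultilinearMap k (fun _ : Pos n => A) A

/-- The differential `δ_n = ∑ (-1)^i (d_i)^*` of higher order Hochschild cohomology over `S²`. -/
def delta (n : ℕ) : Cochain k A n →ₗ[k] Cochain k A (n + 1) :=
  ∑ i : Fin (n + 2), (-1 : k) ^ (i : ℕ) • pointedPull (face n i)

theorem delta_apply (n : ℕ) (f : Cochain k A n) (T : Pos (n + 1) → A) :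
    delta k A n f T = ∑ i : Fin (n + 2), (-1 : k) ^ (i : ℕ) •
      ((∏ v with face n i v = none, T v) * f fun w => ∏ v with face n i v = some w, T v) := by
  simp [delta, pointedPull_apply]

/-- The cocycles in degree `n`. -/
abbrev cocycles (n : ℕ) : Submodule k (Cochain k A n) := LinearMap.ker (delta k A n)

/-- The coboundaries in degree `n`. -/
def coboundaries : (n : ℕ) → Submodule k (Cochain k A n)
  | 0 => ⊥
  | n + 1 => LinearMap.range (delta k A n)

/-- The higher order Hochschild cohomology `H^n_{S²}(A, A)`. -/
abbrev Cohomology (n : ℕ) : Type _ :=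
  Subquotient (k := k) (M := Cochain k A n) (cocycles k A n) (coboundaries k A n)

/-- The class of a cocycle, in the direct sum of all `H^n_{S²}(A, A)`. -/
def cls (n : ℕ) (f : cocycles k A n) : ⨁ n, Cohomology k A n :=
  DirectSum.lof k ℕ (Cohomology k A) n
    (Subquotient.mk (k := k) (M := Cochain k A n) (cocycles k A n) (coboundaries k A n) f)

end Cochains

/-! ### The operad -/

/-- The monotone map that collapses the block `i, …, i + m - 1` to `i`. -/
def collapse (i m s : ℕ) : ℕ := if s < i then s else if s < i + m then i else s + 1 - m

/-- The map on positions behind `∘_i`: the positions in the triangle on the block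
`i, …, i + m - 1` are the arguments of the second map, the others collapse to those of the first. -/
def split {n m r : ℕ} (h : n + m = r + 1) (i : Fin n) (v : Pos r) : Pos n ⊕ Pos m :=
  if hb : (i : ℕ) ≤ v.1.1 ∧ (v.1.2 : ℕ) < i + m then
    Sum.inr ⟨(⟨(v.1.1 : ℕ) - i, by have := v.2; simp only [Fin.lt_def] at this; omega⟩,
      ⟨(v.1.2 : ℕ) - i, by have := v.2; simp only [Fin.lt_def] at this; omega⟩), by
        have := v.2
        simp only [Fin.lt_def] at this ⊢
        omega⟩
  else
    Sum.inl ⟨(⟨collapse i m v.1.1, by unfold collapse; split_ifs <;> omega⟩,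
      ⟨collapse i m v.1.2, by unfold collapse; split_ifs <;> omega⟩), by
        have := v.2
        simp only [Fin.lt_def] at this ⊢
        unfold collapse
        split_ifs <;> omega⟩

section Operad

variable {k A : Type*} [CommRing k] [CommRing A] [Algebra k A]

theorem split_eq_inl {n m r : ℕ} (h : n + m = r + 1) (i : Fin n) (v : Pos r) (w : Pos n) :
    split h i v = Sum.inl w ↔
      collapse i m v.1.1 = w.1.1 ∧ collapse i m v.1.2 = w.1.2 := by
  have hv := v.2
  have hw := w.2
  simp only [Fin.lt_def] at hv hw
  unfold split
  split_ifs with hb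
  · simp only [false_iff]
    unfold collapse
    split_ifs <;> omega
  · simp [Subtype.ext_iff, Prod.ext_iff, Fin.ext_iff]

/-- The position `(i + s, i + t)` of the triangle on the block that starts at `i`. -/
def shift {n m r : ℕ} (h : n + m = r + 1) (i : Fin n) (w : Pos m) : Pos r :=
  ⟨(⟨i + w.1.1, by have := w.1.1.2; have := w.1.2.2; have := w.2; omega⟩,
    ⟨i + w.1.2, by have := w.1.1.2; have := w.1.2.2; have := w.2; omega⟩), by
      have := w.2
      simp only [Fin.lt_def] at this ⊢
      omega⟩

theorem split_eq_inr {n m r : ℕ} (h : n + m = r + 1) (i : Fin n) (v : Pos r) (w : Pos m) :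
    split h i v = Sum.inr w ↔ v = shift h i w := by
  have hv := v.2
  have hw := w.2
  simp only [Fin.lt_def] at hv hw
  unfold split shift
  split_ifs with hb
  · simp only [Sum.inr.injEq, Subtype.ext_iff, Prod.ext_iff, Fin.ext_iff]
    omega
  · simp only [false_iff, Subtype.ext_iff, Prod.ext_iff, Fin.ext_iff]
    omega

/-- The partial composition `f ∘_i g` (with `i` counted from `0`), for `f` of degree `n`, `g` of
degree `m` and `r = n + m - 1`. -/
def comp {n m r : ℕ} (h : n + m = r + 1) (i : Fin n) (f : Cochain k A n) (g : Cochain k A m) :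
    Cochain k A r :=
  pull (split h i) (sumMul f g)

/-- The value of `f ∘_i g` at a tensor matrix `T`: the triangle of `T` on the block
`i, …, i + m - 1` is put into `g`, and what remains is put into `f` after the rows and columns of
the block have been multiplied together. -/
theorem comp_apply {n m r : ℕ} (h : n + m = r + 1) (i : Fin n) (f : Cochain k A n)
    (g : Cochain k A m) (T : Pos r → A) :
    comp h i f g T =
      f (fun w => ∏ v : Pos r with
          collapse i m v.1.1 = w.1.1 ∧ collapse i m v.1.2 = w.1.2, T v) *
        g (fun w => T (shift h i w)) := by
  rw [comp, pull_apply, sumMul_apply]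
  congr 2
  · funext w
    exact Finset.prod_congr (Finset.filter_congr fun v _ => split_eq_inl h i v w) fun _ _ => rfl
  · funext w
    refine (Finset.prod_eq_single (shift h i w) (fun v hv hne => ?_) fun hn => ?_)
    · exact absurd ((split_eq_inr h i v w).1 (Finset.mem_filter.1 hv).2) hne
    · exact (hn (Finset.mem_filter.2 ⟨Finset.mem_univ (shift h i w),
        (split_eq_inr h i (shift h i w) w).2 rfl⟩)).elim

/-- `f ∘ g = ∑ (-1)^{(i-1)(m-1)} f ∘_i g`, with `i` from `1` to `n` and `m` the degree of `g`. Here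
`i` is counted from `0`, and `m + 1` replaces `m - 1`, which has the same parity. -/
def circ {n m r : ℕ} (h : n + m = r + 1) (f : Cochain k A n) (g : Cochain k A m) :
    Cochain k A r :=
  ∑ i : Fin n, (-1 : k) ^ ((i : ℕ) * (m + 1)) • comp h i f g

/-- `[f, g] = f ∘ g - (-1)^{(n-1)(m-1)} g ∘ f`. -/
def bracket {n m r : ℕ} (h : n + m = r + 1) (f : Cochain k A n) (g : Cochain k A m) :
    Cochain k A r :=
  circ h f g - (-1 : k) ^ ((n + 1) * (m + 1)) • circ ((Nat.add_comm m n).trans h) g f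

variable (k A) in
/-- The multiplication `𝔪` of the operad: the value at a `2 × 2` tensor matrix is its only entry
above the diagonal. -/
def mult : Cochain k A 2 := MultilinearMap.mkPiAlgebra k (Pos 2) A

theorem mult_apply (T : Pos 2 → A) : mult k A T = T ⟨(0, 1), by decide⟩ := by
  have : (Finset.univ : Finset (Pos 2)) = {⟨(0, 1), by decide⟩} := by decide
  simp [mult, this]

/-- The differential `d f = 𝔪 ∘ f - (-1)^{n-1} f ∘ 𝔪` of the operad with multiplication. -/
def opDiff {n : ℕ} (f : Cochain k A n) : Cochain k A (n + 1) :=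
  circ (by omega) (mult k A) f - (-1 : k) ^ (n + 1) • circ (by omega) f (mult k A)

/-- The brace `𝔪{f, g} = (-1)^{(m-1)n} 𝔪(f, g)`, where `𝔪(f, g) = (𝔪 ∘_2 g) ∘_1 f`; here `n` and
`m` are the degrees of `f` and `g`. (In a brace `x{y, z}` each of `y` and `z` contributes the sign
with exponent its degree minus one times the number of inputs in front of it.) -/
def multBrace {n m r : ℕ} (h : n + m = r) (f : Cochain k A n) (g : Cochain k A m) :
    Cochain k A r :=
  (-1 : k) ^ ((m + 1) * n) •
    comp (n := m + 1) (by omega) 0 (comp (r := m + 1) (by omega) 1 (mult k A) g) f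

/-- The cup product `f · g = (-1)^{|f|+1} 𝔪{f, g}`, where `|f| = n - 1`. -/
def cup {n m r : ℕ} (h : n + m = r) (f : Cochain k A n) (g : Cochain k A m) : Cochain k A r :=
  (-1 : k) ^ n • multBrace h f g

end Operad

/-! ### Gerstenhaber algebras -/

/-- A `G`-algebra (Gerstenhaber algebra) structure on the graded `k`-module `⨁ n, H n`. -/
structure GAlgebra (k : Type*) [CommRing k] (H : ℕ → Type*) [∀ n, AddCommGroup (H n)]
    [∀ n, Module k (H n)] where
  /-- The cup product. -/
  mul : (⨁ n, H n) →ₗ[k] (⨁ n, H n) →ₗ[k] ⨁ n, H n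
  /-- The bracket. -/
  lie : (⨁ n, H n) →ₗ[k] (⨁ n, H n) →ₗ[k] ⨁ n, H n
  /-- The product of elements of degrees `p` and `q` has degree `p + q`. -/
  mul_degree : ∀ (p q r : ℕ) (x : H p) (y : H q), r ≠ p + q →
    mul (DirectSum.lof k ℕ H p x) (DirectSum.lof k ℕ H q y) r = 0
  /-- The bracket of elements of degrees `p` and `q` has degree `p + q - 1`. -/
  lie_degree : ∀ (p q r : ℕ) (x : H p) (y : H q), r + 1 ≠ p + q →
    lie (DirectSum.lof k ℕ H p x) (DirectSum.lof k ℕ H q y) r = 0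
  mul_assoc : ∀ x y z : ⨁ n, H n, mul (mul x y) z = mul x (mul y z)
  /-- `x · y = (-1)^{pq} y · x`. -/
  mul_comm : ∀ (p q : ℕ) (x : H p) (y : H q),
    mul (DirectSum.lof k ℕ H p x) (DirectSum.lof k ℕ H q y) =
      (-1 : k) ^ (p * q) • mul (DirectSum.lof k ℕ H q y) (DirectSum.lof k ℕ H p x)
  /-- `[x, y] = -(-1)^{(p-1)(q-1)} [y, x]`. -/
  lie_skew : ∀ (p q : ℕ) (x : H p) (y : H q),
    lie (DirectSum.lof k ℕ H p x) (DirectSum.lof k ℕ H q y) =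
      -((-1 : k) ^ ((p + 1) * (q + 1)) •
        lie (DirectSum.lof k ℕ H q y) (DirectSum.lof k ℕ H p x))
  /-- The graded Jacobi identity `[x, [y, z]] = [[x, y], z] + (-1)^{(p-1)(q-1)} [y, [x, z]]`. -/
  lie_jacobi : ∀ (p q : ℕ) (x : H p) (y : H q) (z : ⨁ n, H n),
    lie (DirectSum.lof k ℕ H p x) (lie (DirectSum.lof k ℕ H q y) z) =
      lie (lie (DirectSum.lof k ℕ H p x) (DirectSum.lof k ℕ H q y)) z +
      (-1 : k) ^ ((p + 1) * (q + 1)) •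
        lie (DirectSum.lof k ℕ H q y) (lie (DirectSum.lof k ℕ H p x) z)
  /-- The graded Leibniz identity `[x, y · z] = [x, y] · z + (-1)^{(p-1)q} y · [x, z]`. -/
  lie_mul : ∀ (p q : ℕ) (x : H p) (y : H q) (z : ⨁ n, H n),
    lie (DirectSum.lof k ℕ H p x) (mul (DirectSum.lof k ℕ H q y) z) =
      mul (lie (DirectSum.lof k ℕ H p x) (DirectSum.lof k ℕ H q y)) z +
      (-1 : k) ^ ((p + 1) * q) •
        mul (DirectSum.lof k ℕ H q y) (lie (DirectSum.lof k ℕ H p x) z)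

end HigherHochschildS2

/-! The cochains form a nonsymmetric operad with multiplication, and the classical argument for such
operads gives the Gerstenhaber structure.

The operad axioms come from maps of finite sets. A partial composition is the pullback of the
product `sumMul f g` along `split`, so nested compositions (`comp_comp`) and parallel ones
(`comp_right_comm`) reduce to equalities between maps of positions, that is, to arithmetic of
`collapse`. Both partial compositions of 𝔪 with itself multiply the three entries of a triangle;
with signs they cancel in 𝔪 ∘ 𝔪 (`tcirc_mult_mult`).

The associator of ∘ is a sum of two braces (`tcirc_tcirc`), which gives the Jacobi identity, and d =
[𝔪, -] has square zero. The expansions of f{g, h} ∘ u and (f ∘ u){g, h} (`tcirc_brace`,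
`brace_tcirc`), with 𝔪 among the entries, show that d is a graded derivation of 𝔪{f, g} and that,
for cocycles, [f, -] obeys the Leibniz rule up to the coboundary of f{g, h} (`tbracket_mulBrace`).
Graded commutativity holds up to the coboundary of f ∘ g (`mulBrace_comm`). Associativity of the cup
product is strict.

On the simplicial side, the outer faces of S² give the two compositions of f into 𝔪, and the inner
faces give those of 𝔪 into f; hence `delta_eq`.

To avoid carrying degree equations, operations are extended by zero whenever the target degree does
not fit. The truncated differences `n + m - 1` are then harmless, at the price of some cases in low
degree. -/

namespace HigherHochschildS2

/-! ### Functoriality of pullbacks and products of multilinear maps. -/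

section PullLemmas

variable {k A U V W : Type*} [CommRing k] [CommRing A] [Algebra k A]

/-- Fibres of a composite are unions of fibres of the first map. This functoriality reduces
identities between iterated compositions to identities between maps of index sets. -/
theorem pull_pull [Fintype U] [Fintype V] [DecidableEq V] [DecidableEq W] (φ : U → V) (ψ : V → W)
    (f : MultilinearMap k (fun _ : W => A) A) : pull φ (pull ψ f) = pull (ψ ∘ φ) f := by
  ext a
  simp only [pull_apply]
  congr 1
  funext w
  rw [← Finset.prod_fiberwise_of_maps_to (s := Finset.univ.filter fun u => (ψ ∘ φ) u = w)
    (t := Finset.univ.filter fun v => ψ v = w) (g := φ)]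
  · refine Finset.prod_congr rfl fun v hv => Finset.prod_congr ?_ fun _ _ => rfl
    ext u
    simp only [Finset.mem_filter, Finset.mem_univ, true_and, Function.comp] at hv ⊢
    constructor
    · rintro rfl
      exact ⟨hv, rfl⟩
    · exact fun h => h.2
  · intro u hu
    simpa using hu

theorem pull_equiv [Fintype V] [DecidableEq W] (e : V ≃ W)
    (f : MultilinearMap k (fun _ : W => A) A) (a : V → A) :
    pull e f a = f fun w => a (e.symm w) := by
  rw [pull_apply]
  congr 1
  funext w
  have : (Finset.univ.filter fun v => e v = w) = {e.symm w} := by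
    ext v
    simp [Equiv.eq_symm_apply]
  rw [this, Finset.prod_singleton]

theorem pull_id [Fintype V] [DecidableEq V] (f : MultilinearMap k (fun _ : V => A) A) :
    pull id f = f := by
  ext a
  exact pull_equiv (Equiv.refl V) f a

theorem sumMul_pull {V₁ V₂ W₁ W₂ : Type*} [Fintype V₁] [Fintype V₂] [DecidableEq W₁]
    [DecidableEq W₂] (φ : V₁ → W₁) (ψ : V₂ → W₂) (f : MultilinearMap k (fun _ : W₁ => A) A)
    (g : MultilinearMap k (fun _ : W₂ => A) A) :
    sumMul (pull φ f) (pull ψ g) = pull (Sum.map φ ψ) (sumMul f g) := by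
  ext a
  simp only [sumMul_apply, pull_apply]
  congr 2 <;> funext w <;> simp [Finset.prod_filter]

theorem sumMul_assoc {V₁ V₂ V₃ : Type*} [Fintype V₁] [Fintype V₂] [Fintype V₃] [DecidableEq V₁]
    [DecidableEq V₂] [DecidableEq V₃] (f : MultilinearMap k (fun _ : V₁ => A) A)
    (g : MultilinearMap k (fun _ : V₂ => A) A) (h : MultilinearMap k (fun _ : V₃ => A) A) :
    sumMul (sumMul f g) h = pull (Equiv.sumAssoc V₁ V₂ V₃) (sumMul f (sumMul g h)) := by
  ext a
  simp [pull_equiv, sumMul_apply, mul_assoc]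

/-- Interchange of the last two summands. -/
def sumRightComm (V₁ V₂ V₃ : Type*) : (V₁ ⊕ V₂) ⊕ V₃ ≃ (V₁ ⊕ V₃) ⊕ V₂ :=
  (Equiv.sumAssoc V₁ V₂ V₃).trans
    (((Equiv.refl V₁).sumCongr (Equiv.sumComm V₂ V₃)).trans (Equiv.sumAssoc V₁ V₃ V₂).symm)

theorem sumRightComm_inl_inl {V₁ V₂ V₃ : Type*} (v : V₁) :
    sumRightComm V₁ V₂ V₃ (Sum.inl (Sum.inl v)) = Sum.inl (Sum.inl v) := rfl

theorem sumRightComm_inl_inr {V₁ V₂ V₃ : Type*} (v : V₂) :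
    sumRightComm V₁ V₂ V₃ (Sum.inl (Sum.inr v)) = Sum.inr v := rfl

theorem sumRightComm_inr {V₁ V₂ V₃ : Type*} (v : V₃) :
    sumRightComm V₁ V₂ V₃ (Sum.inr v) = Sum.inl (Sum.inr v) := rfl

theorem sumMul_right_comm {V₁ V₂ V₃ : Type*} [Fintype V₁] [Fintype V₂] [Fintype V₃]
    [DecidableEq V₁] [DecidableEq V₂] [DecidableEq V₃] (f : MultilinearMap k (fun _ : V₁ => A) A)
    (g : MultilinearMap k (fun _ : V₂ => A) A) (h : MultilinearMap k (fun _ : V₃ => A) A) :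
    sumMul (sumMul f g) h = pull (sumRightComm V₁ V₂ V₃) (sumMul (sumMul f h) g) := by
  ext a
  rw [pull_equiv]
  change _ = sumMul (sumMul f h) g (fun w => a ((sumRightComm V₁ V₂ V₃).symm w))
  simp only [sumMul_apply]
  exact mul_right_comm _ _ _

end PullLemmas

/-! ### The operad axioms. -/

section Comp

variable {k A : Type*} [CommRing k] [CommRing A] [Algebra k A]

theorem collapse_collapse {i j m l t : ℕ} (h : m + l = t + 1) (hj : j < m) (s : ℕ) :
    collapse i m (collapse (i + j) l s) = collapse i t s := by
  unfold collapse
  split_ifs <;> omega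

/-- Two disjoint blocks may be collapsed in either order; `a = j + m - 1` is where the right block
starts while the left one is still expanded. -/
theorem collapse_right_comm {i j m l a : ℕ} (hij : i < j) (ha : a + 1 = j + m) (s : ℕ) :
    collapse i m (collapse a l s) = collapse j l (collapse i m s) := by
  unfold collapse
  grind

theorem collapse_mem_block {i j m l t : ℕ} (h : m + l = t + 1) (hj : j < m) (u v : ℕ) :
    (i ≤ collapse (i + j) l u ∧ collapse (i + j) l v < i + m) ↔ (i ≤ u ∧ v < i + t) := by
  unfold collapse
  grind

theorem collapse_sub {i j l s : ℕ} (hs : i ≤ s) :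
    collapse (i + j) l s - i = collapse j l (s - i) := by
  unfold collapse
  grind

theorem collapse_mem_left_block {i j m a : ℕ} (l : ℕ) (hij : i < j) (ha : a + 1 = j + m)
    (u v : ℕ) :
    (i ≤ collapse a l u ∧ collapse a l v < i + m) ↔ (i ≤ u ∧ v < i + m) := by
  unfold collapse
  grind

theorem collapse_mem_right_block {i j m a : ℕ} (l : ℕ) (hij : i < j) (ha : a + 1 = j + m)
    (u v : ℕ) :
    (j ≤ collapse i m u ∧ collapse i m v < j + l) ↔ (a ≤ u ∧ v < a + l) := by
  unfold collapse
  grind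

theorem collapse_left_sub {i j m a s : ℕ} (l : ℕ) (hij : i < j) (ha : a + 1 = j + m)
    (hs : s < i + m) : collapse a l s = s := by
  unfold collapse
  grind

theorem collapse_right_sub {i j m a : ℕ} (hij : i < j) (ha : a + 1 = j + m) (s : ℕ) :
    collapse i m s - j = s - a := by
  unfold collapse
  grind

theorem split_of_mem {n m r : ℕ} (h : n + m = r + 1) (i : Fin n) (v : Pos r)
    (hb : (i : ℕ) ≤ v.1.1 ∧ (v.1.2 : ℕ) < i + m) :
    split h i v = Sum.inr ⟨(⟨(v.1.1 : ℕ) - i, by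
      have := v.2; simp only [Fin.lt_def] at this; omega⟩,
      ⟨(v.1.2 : ℕ) - i, by have := v.2; simp only [Fin.lt_def] at this; omega⟩), by
        have := v.2
        simp only [Fin.lt_def] at this ⊢
        omega⟩ := dif_pos hb

theorem split_of_not_mem {n m r : ℕ} (h : n + m = r + 1) (i : Fin n) (v : Pos r)
    (hb : ¬((i : ℕ) ≤ v.1.1 ∧ (v.1.2 : ℕ) < i + m)) :
    split h i v = Sum.inl ⟨(⟨collapse i m v.1.1, by unfold collapse; split_ifs <;> omega⟩,
      ⟨collapse i m v.1.2, by unfold collapse; split_ifs <;> omega⟩), by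
        have := v.2
        simp only [Fin.lt_def] at this ⊢
        unfold collapse
        split_ifs <;> omega⟩ := dif_neg hb

/-- Nested composition: both sides are pullbacks of the triple product of `f`, `g`, `h`, and the two
maps sort a position in the same way, into the triangle of `h`, the rest of the outer block (for
`g`), or the remainder (for `f`). -/
theorem comp_comp {n m l s t r : ℕ} (h₁ : n + m = s + 1) (h₂ : s + l = r + 1) (h₃ : m + l = t + 1)
    (h₄ : n + t = r + 1) (i : Fin n) (j : Fin m) (a : Fin s) (ha : (a : ℕ) = i + j)
    (f : Cochain k A n) (g : Cochain k A m) (h : Cochain k A l) :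
    comp h₂ a (comp h₁ i f g) h = comp h₄ i f (comp h₃ j g h) := by
  unfold comp
  conv_lhs => rw [← pull_id h, sumMul_pull, pull_pull, sumMul_assoc, pull_pull]
  conv_rhs => rw [← pull_id f, sumMul_pull, pull_pull]
  congr 1
  funext v
  have hv : (v.1.1 : ℕ) < v.1.2 := v.2
  have hj := j.2
  simp only [Function.comp]
  by_cases c₁ : (a : ℕ) ≤ v.1.1 ∧ (v.1.2 : ℕ) < a + l
  · rw [split_of_mem h₂ a v c₁, split_of_mem h₄ i v (by omega)]
    simp only [Sum.map_inr, Equiv.sumAssoc_apply_inr, id]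
    rw [split_of_mem h₃ j]
    · simp only [Sum.inr.injEq, Subtype.mk.injEq, Prod.mk.injEq, Fin.mk.injEq]
      omega
    · simp only
      omega
  · rw [split_of_not_mem h₂ a v c₁]
    simp only [Sum.map_inl]
    by_cases c₂ : (i : ℕ) ≤ v.1.1 ∧ (v.1.2 : ℕ) < i + t
    · rw [split_of_mem h₄ i v c₂, split_of_mem h₁ i]
      · simp only [Sum.map_inr, Equiv.sumAssoc_apply_inl_inr]
        rw [split_of_not_mem h₃ j]
        · simp only [Sum.inr.injEq, Sum.inl.injEq, Subtype.mk.injEq, Prod.mk.injEq, Fin.mk.injEq,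
            ha]
          exact ⟨collapse_sub c₂.1, collapse_sub (c₂.1.trans hv.le)⟩
        · simp only
          omega
      · simpa only [ha] using (collapse_mem_block h₃ hj _ _).2 c₂
    · rw [split_of_not_mem h₄ i v c₂, split_of_not_mem h₁ i]
      · simp only [Sum.map_inl, Equiv.sumAssoc_apply_inl_inl, id]
        simp only [Sum.inl.injEq, Subtype.mk.injEq, Prod.mk.injEq, Fin.mk.injEq, ha]
        exact ⟨collapse_collapse h₃ hj _, collapse_collapse h₃ hj _⟩
      · simpa only [ha] using mt (collapse_mem_block h₃ hj _ _).1 c₂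

/-- Parallel composition: the triangles of `g` and `h` lie on disjoint blocks, so a position goes to
the same place whichever is cut out first. Commutativity of `A` lets the two factors change places.
-/
theorem comp_right_comm {n m l s t r : ℕ} (h₁ : n + m = s + 1) (h₂ : s + l = r + 1)
    (h₃ : n + l = t + 1) (h₄ : t + m = r + 1) (i j : Fin n) (hij : i < j) (a : Fin s) (b : Fin t)
    (ha : (a : ℕ) + 1 = j + m) (hb : (b : ℕ) = i)
    (f : Cochain k A n) (g : Cochain k A m) (h : Cochain k A l) :
    comp h₂ a (comp h₁ i f g) h = comp h₄ b (comp h₃ j f h) g := by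
  unfold comp
  conv_lhs => rw [← pull_id h, sumMul_pull, pull_pull, sumMul_right_comm, pull_pull]
  conv_rhs => rw [← pull_id g, sumMul_pull, pull_pull]
  congr 1
  funext v
  have hv : (v.1.1 : ℕ) < v.1.2 := v.2
  replace hij : (i : ℕ) < j := hij
  simp only [Function.comp]
  by_cases c₁ : (a : ℕ) ≤ v.1.1 ∧ (v.1.2 : ℕ) < a + l
  · rw [split_of_mem h₂ a v c₁, split_of_not_mem h₄ b v (by omega)]
    simp only [Sum.map_inr, Sum.map_inl, sumRightComm_inr, id]
    rw [split_of_mem h₃ j]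
    · simp only [Sum.inl.injEq, Sum.inr.injEq, Subtype.mk.injEq, Prod.mk.injEq, Fin.mk.injEq, hb]
      exact ⟨(collapse_right_sub hij ha _).symm, (collapse_right_sub hij ha _).symm⟩
    · simpa only [hb] using (collapse_mem_right_block l hij ha _ _).2 c₁
  · rw [split_of_not_mem h₂ a v c₁]
    simp only [Sum.map_inl]
    by_cases c₂ : (b : ℕ) ≤ v.1.1 ∧ (v.1.2 : ℕ) < b + m
    · rw [split_of_mem h₄ b v c₂, split_of_mem h₁ i]
      · simp only [Sum.map_inr, sumRightComm_inl_inr, id]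
        simp only [Sum.inr.injEq, Subtype.mk.injEq, Prod.mk.injEq, Fin.mk.injEq, hb]
        rw [hb] at c₂
        rw [collapse_left_sub l hij ha c₂.2, collapse_left_sub l hij ha (hv.trans c₂.2)]
        exact ⟨rfl, rfl⟩
      · rw [hb] at c₂
        exact (collapse_mem_left_block l hij ha _ _).2 c₂
    · rw [split_of_not_mem h₄ b v c₂, split_of_not_mem h₁ i]
      · simp only [Sum.map_inl, sumRightComm_inl_inl]
        refine congrArg Sum.inl ((split_eq_inl h₃ j _ _).2 ⟨?_, ?_⟩).symm
        · simpa only [hb] using (collapse_right_comm hij ha _).symm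
        · simpa only [hb] using (collapse_right_comm hij ha _).symm
      · rw [hb] at c₂
        exact mt (collapse_mem_left_block l hij ha _ _).1 c₂

end Comp

/-! ### Splitting sums over the inputs of a composite. -/

section Sums

variable {M : Type*} [AddCommMonoid M]

/-- Positivity of `c` makes `j + m - 1` an honest shift even for `m = 0`, where it lowers the index
by one. -/
theorem sum_Ico_add_sub_one {c : ℕ} (hc : 0 < c) (d m : ℕ) (F : ℕ → M) :
    ∑ j ∈ Finset.Ico c d, F (j + m - 1) = ∑ s ∈ Finset.Ico (c + m - 1) (d + m - 1), F s := by
  obtain ⟨c, rfl⟩ : ∃ c', c = c' + 1 := ⟨c - 1, by omega⟩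
  rcases d with _ | d
  · rw [Finset.Ico_eq_empty (by omega), Finset.Ico_eq_empty (by omega)]
    simp
  · have e₁ : c + 1 + m - 1 = c + m := by omega
    have e₂ : d + 1 + m - 1 = d + m := by omega
    rw [e₁, e₂, ← Finset.sum_Ico_add', ← Finset.sum_Ico_add']
    refine Finset.sum_congr rfl fun j _ => ?_
    congr 1
    omega

theorem sum_Ico_add_range (a m : ℕ) (F : ℕ → M) :
    ∑ t ∈ Finset.range m, F (a + t) = ∑ s ∈ Finset.Ico a (a + m), F s := by
  rw [Finset.sum_Ico_eq_sum_range, Nat.add_sub_cancel_left]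

/-- An input of a composite `f ∘_i g` is an input of `f` before `i`, an input of `g`, or an input `j
> i` of `f`, which has moved to `j + m - 1`. -/
theorem sum_Ico_block {b i n : ℕ} (m : ℕ) (hb : b ≤ i) (hi : i < n) (F : ℕ → M) :
    ∑ s ∈ Finset.Ico b (n + m - 1), F s =
      ∑ s ∈ Finset.Ico b i, F s + ∑ t ∈ Finset.range m, F (i + t) +
        ∑ j ∈ Finset.Ico (i + 1) n, F (j + m - 1) := by
  rw [sum_Ico_add_sub_one (Nat.succ_pos i), sum_Ico_add_range,
    Finset.sum_Ico_consecutive _ hb (by omega), show i + 1 + m - 1 = i + m by omega,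
    Finset.sum_Ico_consecutive _ (by omega) (by omega)]

theorem sum_range_block {i n : ℕ} (m : ℕ) (hi : i < n) (F : ℕ → M) :
    ∑ s ∈ Finset.range (n + m - 1), F s =
      ∑ s ∈ Finset.range i, F s + ∑ t ∈ Finset.range m, F (i + t) +
        ∑ j ∈ Finset.Ico (i + 1) n, F (j + m - 1) := by
  simpa only [Finset.range_eq_Ico] using sum_Ico_block m (Nat.zero_le i) hi F

theorem sum_Ico_from_block {i t m n : ℕ} (ht : t < m) (hi : i < n) (F : ℕ → M) :
    ∑ s ∈ Finset.Ico (i + t + 1) (n + m - 1), F s =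
      ∑ t' ∈ Finset.Ico (t + 1) m, F (i + t') + ∑ j ∈ Finset.Ico (i + 1) n, F (j + m - 1) := by
  rw [sum_Ico_add_sub_one (Nat.succ_pos i), Finset.sum_Ico_add,
    show i + 1 + m - 1 = m + i by omega, show t + 1 + i = i + t + 1 by omega,
    Finset.sum_Ico_consecutive _ (by omega) (by omega)]

end Sums

/-! ### Signed compositions and the pre-Lie identity. -/

section Operad

variable {k A : Type*} [CommRing k] [CommRing A] [Algebra k A]

/-- Exponents of signs matter only in `ZMod 2`, where the polynomial congruences below are settled
by `decide`. -/
theorem neg_one_pow_congr {a b : ℕ} (h : (a : ZMod 2) = b) : (-1 : k) ^ a = (-1) ^ b := by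
  rw [neg_one_pow_eq_pow_mod_two, (ZMod.natCast_eq_natCast_iff' a b 2).1 h,
    ← neg_one_pow_eq_pow_mod_two]

theorem comp_add_left {n m r : ℕ} (h : n + m = r + 1) (i : Fin n) (f f' : Cochain k A n)
    (g : Cochain k A m) : comp h i (f + f') g = comp h i f g + comp h i f' g := by
  ext T
  simp [comp_apply, add_mul]

theorem comp_smul_left {n m r : ℕ} (h : n + m = r + 1) (i : Fin n) (c : k) (f : Cochain k A n)
    (g : Cochain k A m) : comp h i (c • f) g = c • comp h i f g := by
  ext T
  simp [comp_apply]

theorem comp_add_right {n m r : ℕ} (h : n + m = r + 1) (i : Fin n) (f : Cochain k A n)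
    (g g' : Cochain k A m) : comp h i f (g + g') = comp h i f g + comp h i f g' := by
  ext T
  simp [comp_apply, mul_add]

theorem comp_smul_right {n m r : ℕ} (h : n + m = r + 1) (i : Fin n) (c : k) (f : Cochain k A n)
    (g : Cochain k A m) : comp h i f (c • g) = c • comp h i f g := by
  ext T
  simp [comp_apply]

/-- The partial composition `f ∘_i g` as a bilinear map. -/
def compLinear {n m r : ℕ} (h : n + m = r + 1) (i : Fin n) :
    Cochain k A n →ₗ[k] Cochain k A m →ₗ[k] Cochain k A r where
  toFun f :=
    { toFun := fun g => comp h i f g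
      map_add' := fun g g' => comp_add_right h i f g g'
      map_smul' := fun c g => comp_smul_right h i c f g }
  map_add' f f' := LinearMap.ext fun g => comp_add_left h i f f' g
  map_smul' c f := LinearMap.ext fun g => comp_smul_left h i c f g

/-- The partial composition `f ∘_i g` with the sign `(-1)^{i(m-1)}`, bilinear, and zero unless
`i < n` and `r = n + m - 1`. -/
def pcomp {n m : ℕ} (r i : ℕ) : Cochain k A n →ₗ[k] Cochain k A m →ₗ[k] Cochain k A r :=
  if h : n + m = r + 1 ∧ i < n then
    (-1 : k) ^ (i * (m + 1)) • compLinear h.1 ⟨i, h.2⟩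
  else 0

theorem pcomp_eq {n m r i : ℕ} (h : n + m = r + 1) (hi : i < n) (f : Cochain k A n)
    (g : Cochain k A m) : pcomp r i f g = (-1 : k) ^ (i * (m + 1)) • comp h ⟨i, hi⟩ f g := by
  rw [pcomp, dif_pos ⟨h, hi⟩]
  rfl

theorem pcomp_eq_zero {n m r i : ℕ} (h : n + m ≠ r + 1) (f : Cochain k A n)
    (g : Cochain k A m) : pcomp r i f g = 0 := by
  rw [pcomp, dif_neg fun h' => h h'.1]
  rfl

/-- The built-in signs make the nested axiom sign-free: as `t - 1 = (m - 1) + (l - 1)`, the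
exponents `i(m-1) + (i+j)(l-1)` and `i(t-1) + j(l-1)` agree. -/
theorem pcomp_pcomp {n m l s t r i j : ℕ} (h₁ : n + m = s + 1) (h₂ : s + l = r + 1)
    (h₃ : m + l = t + 1) (hi : i < n) (hj : j < m)
    (f : Cochain k A n) (g : Cochain k A m) (h : Cochain k A l) :
    pcomp r (i + j) (pcomp s i f g) h = pcomp r i f (pcomp t j g h) := by
  have h₄ : n + t = r + 1 := by omega
  rw [pcomp_eq h₁ hi, pcomp_eq h₃ hj, map_smul, LinearMap.smul_apply, map_smul,
    pcomp_eq h₂ (by omega), pcomp_eq h₄ hi, smul_smul, smul_smul, ← pow_add, ← pow_add,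
    comp_comp h₁ h₂ h₃ h₄ ⟨i, hi⟩ ⟨j, hj⟩ _ rfl]
  congr 1
  apply neg_one_pow_congr
  have e : ((m + l : ℕ) : ZMod 2) = (t + 1 : ℕ) := congrArg _ h₃
  push_cast at e ⊢
  rw [← e]
  generalize (i : ZMod 2) = a, (j : ZMod 2) = b, (m : ZMod 2) = c, (l : ZMod 2) = d
  revert a b c d
  decide

/-- Moving `h` in front of `g` costs the Koszul sign for the shifted degrees `m - 1` and `l - 1`. -/
theorem pcomp_right_comm {n m l s t r i j : ℕ} (h₁ : n + m = s + 1) (h₂ : s + l = r + 1)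
    (h₃ : n + l = t + 1) (hij : i < j) (hj : j < n)
    (f : Cochain k A n) (g : Cochain k A m) (h : Cochain k A l) :
    pcomp r (j + m - 1) (pcomp s i f g) h =
      (-1 : k) ^ ((m + 1) * (l + 1)) • pcomp r i (pcomp t j f h) g := by
  have h₄ : t + m = r + 1 := by omega
  have ha : j + m - 1 + 1 = j + m := by omega
  rw [pcomp_eq h₁ (hij.trans hj), pcomp_eq h₃ hj, map_smul, LinearMap.smul_apply, map_smul,
    LinearMap.smul_apply, pcomp_eq h₂ (by omega), pcomp_eq h₄ (by omega), smul_smul, smul_smul,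
    smul_smul, ← pow_add, ← pow_add, ← pow_add,
    comp_right_comm h₁ h₂ h₃ h₄ ⟨i, hij.trans hj⟩ ⟨j, hj⟩ hij _ ⟨i, by omega⟩ ha rfl]
  congr 1
  apply neg_one_pow_congr
  have e : ((j + m - 1 + 1 : ℕ) : ZMod 2) = (j + m : ℕ) := congrArg _ ha
  rw [Nat.cast_add, Nat.cast_add, Nat.cast_one, ← eq_sub_iff_add_eq] at e
  push_cast [e]
  generalize (i : ZMod 2) = a, (j : ZMod 2) = b, (m : ZMod 2) = c, (l : ZMod 2) = d
  revert a b c d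
  decide

theorem pcomp_right_comm' {n m l s t r i j : ℕ} (h₁ : n + m = s + 1) (h₂ : s + l = r + 1)
    (h₃ : n + l = t + 1) (hij : i < j) (hj : j < n)
    (f : Cochain k A n) (g : Cochain k A m) (h : Cochain k A l) :
    pcomp r i (pcomp t j f h) g =
      (-1 : k) ^ ((m + 1) * (l + 1)) • pcomp r (j + m - 1) (pcomp s i f g) h := by
  rw [pcomp_right_comm h₁ h₂ h₃ hij hj, smul_smul, ← pow_add, Even.neg_one_pow ⟨_, rfl⟩, one_smul]

theorem pcomp_congr {n m l s s' r i a a' : ℕ} (ha : a = a') (hs : s = s') (f : Cochain k A n)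
    (g : Cochain k A m) (h : Cochain k A l) :
    pcomp r a (pcomp s i f g) h = pcomp r a' (pcomp s' i f g) h := by
  rw [ha, hs]

/-- The composition `f ∘ g`, bilinear, and zero unless `r = n + m - 1`. -/
def tcirc {n m : ℕ} (r : ℕ) : Cochain k A n →ₗ[k] Cochain k A m →ₗ[k] Cochain k A r :=
  ∑ i ∈ Finset.range n, pcomp r i

theorem tcirc_apply {n m r : ℕ} (f : Cochain k A n) (g : Cochain k A m) :
    tcirc r f g = ∑ i ∈ Finset.range n, pcomp r i f g := by
  simp [tcirc]

theorem tcirc_eq {n m r : ℕ} (h : n + m = r + 1) (f : Cochain k A n) (g : Cochain k A m) :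
    tcirc r f g = circ h f g := by
  rw [tcirc_apply, circ, Finset.sum_range]
  exact Finset.sum_congr rfl fun i _ => pcomp_eq h i.2 f g

theorem tcirc_eq_zero {n m r : ℕ} (h : n + m ≠ r + 1) (f : Cochain k A n) (g : Cochain k A m) :
    tcirc r f g = 0 := by
  rw [tcirc_apply]
  exact Finset.sum_eq_zero fun i _ => pcomp_eq_zero h f g

/-- The brace `f{g, h} = ∑_{i < j} ± (f ∘_i g) ∘_{j + m - 1} h`. -/
def brace {n m l : ℕ} (r : ℕ) (f : Cochain k A n) (g : Cochain k A m) (h : Cochain k A l) :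
    Cochain k A r :=
  ∑ i ∈ Finset.range n, ∑ j ∈ Finset.Ico (i + 1) n, pcomp r (j + m - 1) (pcomp (n + m - 1) i f g) h

/-- A summand of the brace `f{g, h, u}`. -/
def tripleTerm {n m l p : ℕ} (r a b c : ℕ) (f : Cochain k A n) (g : Cochain k A m)
    (h : Cochain k A l) (u : Cochain k A p) : Cochain k A r :=
  pcomp r (c + m - 1 + l - 1) (pcomp (n + m - 1 + l - 1) (b + m - 1) (pcomp (n + m - 1) a f g) h) u

/-- The brace `f{g, h, u}`. -/
def tripleBrace {n m l p : ℕ} (r : ℕ) (f : Cochain k A n) (g : Cochain k A m)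
    (h : Cochain k A l) (u : Cochain k A p) : Cochain k A r :=
  ∑ a ∈ Finset.range n, ∑ b ∈ Finset.Ico (a + 1) n, ∑ c ∈ Finset.Ico (b + 1) n,
    tripleTerm r a b c f g h u

theorem sum_pcomp_block {n m l s r i : ℕ} (h₁ : n + m = s + 1) (h₂ : s + l = r + 1) (hi : i < n)
    (f : Cochain k A n) (g : Cochain k A m) (h : Cochain k A l) :
    ∑ t ∈ Finset.range m, pcomp r (i + t) (pcomp s i f g) h =
      pcomp r i f (tcirc (m + l - 1) g h) := by
  rw [tcirc_apply, map_sum]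
  refine Finset.sum_congr rfl fun t ht => ?_
  have := Finset.mem_range.1 ht
  exact pcomp_pcomp h₁ h₂ (by omega) hi this f g h

/-- The pre-Lie identity, with the associator expressed by braces. -/
theorem tcirc_tcirc {n m l r : ℕ} (hr : n + m + l = r + 2)
    (f : Cochain k A n) (g : Cochain k A m) (h : Cochain k A l) :
    tcirc r (tcirc (n + m - 1) f g) h = tcirc r f (tcirc (m + l - 1) g h) + brace r f g h +
      (-1 : k) ^ ((m + 1) * (l + 1)) • brace r f h g := by
  -- `h` enters before `g`, inside `g`, or after `g`; the first case is reordered by the parallel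
  -- axiom and becomes a summand of f{h, g}.
  have key : ∀ i ∈ Finset.range n, tcirc r (pcomp (n + m - 1) i f g) h =
      (-1 : k) ^ ((m + 1) * (l + 1)) • (∑ s ∈ Finset.range i,
        pcomp r (i + l - 1) (pcomp (n + l - 1) s f h) g) +
      pcomp r i f (tcirc (m + l - 1) g h) +
      ∑ j ∈ Finset.Ico (i + 1) n, pcomp r (j + m - 1) (pcomp (n + m - 1) i f g) h := by
    intro i hi
    have hi := Finset.mem_range.1 hi
    rw [tcirc_apply, sum_range_block m hi, sum_pcomp_block (by omega) (by omega) hi,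
      Finset.smul_sum]
    congr 2
    refine Finset.sum_congr rfl fun s hs => ?_
    have hs := Finset.mem_range.1 hs
    rw [pcomp_right_comm' (s := n + l - 1) (by omega) (by omega) (by omega) hs hi,
      mul_comm (l + 1)]
  rw [tcirc_apply (n := n) f g, map_sum, LinearMap.sum_apply, Finset.sum_congr rfl key,
    Finset.sum_add_distrib, Finset.sum_add_distrib, ← tcirc_apply, ← Finset.smul_sum]
  simp only [brace, Finset.range_eq_Ico, Finset.sum_Ico_Ico_comm' 0 n]
  abel

end Operad

/-! ### Braces composed with a further cochain. -/

section Operad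

variable {k A : Type*} [CommRing k] [CommRing A] [Algebra k A]

/-- The five summands correspond to `u` entering inside `h`, inside `g`, to the right of `h`,
between `g` and `h`, and to the left of `g`. The signs come from moving `u` past `h`, and past `g`
where needed. -/
theorem tcirc_brace_term {n m l p r i j : ℕ} (hr : n + m + l + p = r + 3) (hij : i < j)
    (hj : j < n) (f : Cochain k A n) (g : Cochain k A m) (h : Cochain k A l) (u : Cochain k A p) :
    tcirc r (pcomp (n + m - 1 + l - 1) (j + m - 1) (pcomp (n + m - 1) i f g) h) u =
      pcomp r (j + m - 1) (pcomp (n + m - 1) i f g) (tcirc (l + p - 1) h u) +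
      (-1 : k) ^ ((l + 1) * (p + 1)) • pcomp r (j + (m + p - 1) - 1)
        (pcomp (n + (m + p - 1) - 1) i f (tcirc (m + p - 1) g u)) h +
      ∑ c ∈ Finset.Ico (j + 1) n, tripleTerm r i j c f g h u +
      (-1 : k) ^ ((l + 1) * (p + 1)) • ∑ b ∈ Finset.Ico (i + 1) j, tripleTerm r i b j f g u h +
      (-1 : k) ^ ((l + 1) * (p + 1)) • (-1 : k) ^ ((m + 1) * (p + 1)) •
        ∑ a ∈ Finset.range i, tripleTerm r a i j f u g h := by
  have hlast : ∑ c ∈ Finset.Ico (j + m - 1 + 1) (n + m - 1), pcomp r (c + l - 1)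
      (pcomp (n + m - 1 + l - 1) (j + m - 1) (pcomp (n + m - 1) i f g) h) u =
      ∑ c ∈ Finset.Ico (j + 1) n, tripleTerm r i j c f g h u := by
    rw [show j + m - 1 + 1 = j + 1 + m - 1 by omega, ← sum_Ico_add_sub_one (Nat.succ_pos j)]
    rfl
  have hfirst : ∑ s ∈ Finset.range (j + m - 1), pcomp r s
      (pcomp (n + m - 1 + l - 1) (j + m - 1) (pcomp (n + m - 1) i f g) h) u =
      (-1 : k) ^ ((l + 1) * (p + 1)) • ∑ s ∈ Finset.range (j + m - 1), pcomp r (j + m - 1 + p - 1)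
        (pcomp (n + m - 1 + p - 1) s (pcomp (n + m - 1) i f g) u) h := by
    rw [Finset.smul_sum]
    refine Finset.sum_congr rfl fun s hs => ?_
    have hs := Finset.mem_range.1 hs
    rw [pcomp_right_comm' (s := n + m - 1 + p - 1) (by omega) (by omega) (by omega) hs (by omega),
      mul_comm (p + 1)]
  -- Two block decompositions: the first is around the block of `h`; the inputs before it are then
  -- split again around the block of `g`, with `j` in the role of the arity of `f`.
  rw [tcirc_apply, sum_range_block l (show j + m - 1 < n + m - 1 by omega), hlast, hfirst,
    sum_pcomp_block (by omega) (by omega) (by omega), sum_range_block m hij]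
  have h₁ : ∑ s ∈ Finset.range i, pcomp r (j + m - 1 + p - 1)
      (pcomp (n + m - 1 + p - 1) s (pcomp (n + m - 1) i f g) u) h =
      (-1 : k) ^ ((m + 1) * (p + 1)) • ∑ a ∈ Finset.range i, tripleTerm r a i j f u g h := by
    rw [Finset.smul_sum]
    refine Finset.sum_congr rfl fun s hs => ?_
    have hs := Finset.mem_range.1 hs
    rw [pcomp_right_comm' (s := n + p - 1) (by omega) (by omega) (by omega) hs (by omega),
      map_smul, LinearMap.smul_apply, mul_comm (p + 1), tripleTerm]
    congr 1
    exact pcomp_congr (by omega) (by omega) _ _ _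
  have h₂ : ∑ t ∈ Finset.range m, pcomp r (j + m - 1 + p - 1)
      (pcomp (n + m - 1 + p - 1) (i + t) (pcomp (n + m - 1) i f g) u) h =
      pcomp r (j + (m + p - 1) - 1)
        (pcomp (n + (m + p - 1) - 1) i f (tcirc (m + p - 1) g u)) h := by
    -- For `m = 0` truncated subtraction can make the two index expressions differ, but both sides
    -- vanish because `g` has no inputs.
    rcases Nat.eq_zero_or_pos m with rfl | hm
    · simp [tcirc_apply]
    · rw [← LinearMap.sum_apply, ← map_sum,
        sum_pcomp_block (by omega) (by omega) (hij.trans hj)]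
      exact pcomp_congr (by omega) (by omega) _ _ _
  have h₃ : ∑ b ∈ Finset.Ico (i + 1) j, pcomp r (j + m - 1 + p - 1)
      (pcomp (n + m - 1 + p - 1) (b + m - 1) (pcomp (n + m - 1) i f g) u) h =
      ∑ b ∈ Finset.Ico (i + 1) j, tripleTerm r i b j f g u h := rfl
  rw [h₁, h₂, h₃, smul_add, smul_add]
  abel

/-- The braces of `f{g, h} ∘ u`. -/
theorem tcirc_brace {n m l p r : ℕ} (hr : n + m + l + p = r + 3)
    (f : Cochain k A n) (g : Cochain k A m) (h : Cochain k A l) (u : Cochain k A p) :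
    tcirc r (brace (n + m - 1 + l - 1) f g h) u =
      brace r f g (tcirc (l + p - 1) h u) +
      (-1 : k) ^ ((l + 1) * (p + 1)) • brace r f (tcirc (m + p - 1) g u) h +
      tripleBrace r f g h u + (-1 : k) ^ ((l + 1) * (p + 1)) • tripleBrace r f g u h +
      (-1 : k) ^ ((l + 1) * (p + 1)) • (-1 : k) ^ ((m + 1) * (p + 1)) •
        tripleBrace r f u g h := by
  rw [brace, map_sum, LinearMap.sum_apply]
  simp only [map_sum, LinearMap.sum_apply]
  rw [Finset.sum_congr (s₁ := Finset.range n) rfl fun i _ =>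
    Finset.sum_congr (s₁ := Finset.Ico (i + 1) n) rfl fun j hj => tcirc_brace_term hr
      (Nat.lt_of_succ_le (Finset.mem_Ico.1 hj).1) (Finset.mem_Ico.1 hj).2 f g h u]
  simp only [Finset.sum_add_distrib, ← Finset.smul_sum]
  congr 1
  · congr 2
    refine Finset.sum_congr rfl fun i _ => ?_
    exact (Finset.sum_Ico_Ico_comm' (i + 1) n fun b j => tripleTerm r i b j f g u h).symm
  · congr 2
    have hc : ∀ i, ∑ j ∈ Finset.Ico (i + 1) n, ∑ a ∈ Finset.range i, tripleTerm r a i j f u g h =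
        ∑ a ∈ Finset.range i, ∑ j ∈ Finset.Ico (i + 1) n, tripleTerm r a i j f u g h :=
      fun i => Finset.sum_comm
    simp only [hc]
    simp only [tripleBrace, Finset.range_eq_Ico]
    exact (Finset.sum_Ico_Ico_comm' 0 n fun a i =>
      ∑ j ∈ Finset.Ico (i + 1) n, tripleTerm r a i j f u g h).symm

/-- With `u` occupying slot `a` of `f`, each of `g` and `h` enters before, inside or after `u`, in
this order; this leaves six cases. Each cochain that ends up to the left of `u` contributes a Koszul
sign. -/
theorem brace_pcomp {n m l p r a : ℕ} (hr : n + m + l + p = r + 3) (ha : a < n)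
    (f : Cochain k A n) (u : Cochain k A p) (g : Cochain k A m) (h : Cochain k A l) :
    brace r (pcomp (n + p - 1) a f u) g h =
      (-1 : k) ^ ((m + 1) * (p + 1)) • (-1 : k) ^ ((l + 1) * (p + 1)) •
        ∑ i ∈ Finset.range a, ∑ j ∈ Finset.Ico (i + 1) a, tripleTerm r i j a f g h u +
      (-1 : k) ^ ((m + 1) * (p + 1)) • ∑ i ∈ Finset.range a, pcomp r (a + m - 1)
        (pcomp (n + m - 1) i f g) (tcirc (p + l - 1) u h) +
      (-1 : k) ^ ((m + 1) * (p + 1)) • ∑ i ∈ Finset.range a, ∑ j ∈ Finset.Ico (a + 1) n,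
        tripleTerm r i a j f g u h +
      pcomp r a f (brace (p + m - 1 + l - 1) u g h) +
      ∑ j ∈ Finset.Ico (a + 1) n, pcomp r (j + (p + m - 1) - 1)
        (pcomp (n + (p + m - 1) - 1) a f (tcirc (p + m - 1) u g)) h +
      ∑ i ∈ Finset.Ico (a + 1) n, ∑ j ∈ Finset.Ico (i + 1) n, tripleTerm r a i j f u g h := by
  rw [brace, sum_range_block p ha]
  have h₁ : ∀ i ∈ Finset.range a, ∑ j ∈ Finset.Ico (i + 1) (n + p - 1),
      pcomp r (j + m - 1) (pcomp (n + p - 1 + m - 1) i (pcomp (n + p - 1) a f u) g) h =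
      (-1 : k) ^ ((m + 1) * (p + 1)) • (-1 : k) ^ ((l + 1) * (p + 1)) •
        ∑ j ∈ Finset.Ico (i + 1) a, tripleTerm r i j a f g h u +
      (-1 : k) ^ ((m + 1) * (p + 1)) •
        pcomp r (a + m - 1) (pcomp (n + m - 1) i f g) (tcirc (p + l - 1) u h) +
      (-1 : k) ^ ((m + 1) * (p + 1)) • ∑ j ∈ Finset.Ico (a + 1) n, tripleTerm r i a j f g u h := by
    intro i hi
    have hi := Finset.mem_range.1 hi
    -- Placing `g` before `u` moves the block of `u` to `a + m - 1`; the inputs available to `h` are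
    -- then split around that block.
    rw [pcomp_right_comm' (s := n + m - 1) (by omega) (by omega) (by omega) hi ha]
    simp only [map_smul, LinearMap.smul_apply]
    rw [← Finset.smul_sum, sum_Ico_block p hi ha, smul_add, smul_add]
    congr 1
    · congr 2
      · rw [Finset.smul_sum]
        refine Finset.sum_congr rfl fun j hj => ?_
        have hj := Finset.mem_Ico.1 hj
        rw [pcomp_right_comm' (s := n + m - 1 + l - 1) (by omega) (by omega) (by omega)
          (show j + m - 1 < a + m - 1 by omega) (by omega)]
        rfl
      · rw [← sum_pcomp_block (s := n + p - 1 + m - 1) (by omega) (by omega) (by omega)]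
        refine Finset.sum_congr rfl fun t _ => ?_
        exact pcomp_congr (by omega) rfl _ _ _
    · congr 1
      refine Finset.sum_congr rfl fun j hj => ?_
      have hj := Finset.mem_Ico.1 hj
      exact pcomp_congr (by omega) (by omega) _ _ _
  have h₂ : ∑ t ∈ Finset.range p, ∑ j ∈ Finset.Ico (a + t + 1) (n + p - 1),
      pcomp r (j + m - 1) (pcomp (n + p - 1 + m - 1) (a + t) (pcomp (n + p - 1) a f u) g) h =
      pcomp r a f (brace (p + m - 1 + l - 1) u g h) +
      ∑ j ∈ Finset.Ico (a + 1) n, pcomp r (j + (p + m - 1) - 1)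
        (pcomp (n + (p + m - 1) - 1) a f (tcirc (p + m - 1) u g)) h := by
    rw [Finset.sum_congr rfl fun t ht => sum_Ico_from_block (Finset.mem_range.1 ht) ha fun j =>
      pcomp r (j + m - 1) (pcomp (n + p - 1 + m - 1) (a + t) (pcomp (n + p - 1) a f u) g) h,
      Finset.sum_add_distrib, Finset.sum_comm (s := Finset.range p) (t := Finset.Ico _ n)]
    congr 1
    · rw [brace, map_sum]
      refine Finset.sum_congr rfl fun t ht => ?_
      have ht := Finset.mem_range.1 ht
      rw [map_sum]
      refine Finset.sum_congr rfl fun t' ht' => ?_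
      have ht' := Finset.mem_Ico.1 ht'
      rw [pcomp_pcomp (t := p + m - 1) (by omega) (by omega) (by omega) ha ht,
        show a + t' + m - 1 = a + (t' + m - 1) by omega,
        pcomp_pcomp (t := p + m - 1 + l - 1) (by omega) (by omega) (by omega) ha (by omega)]
    · refine Finset.sum_congr rfl fun j hj => ?_
      have hj := Finset.mem_Ico.1 hj
      rcases Nat.eq_zero_or_pos p with rfl | hp
      · simp [tcirc_apply]
      · rw [← LinearMap.sum_apply, ← map_sum, sum_pcomp_block (by omega) (by omega) ha]
        exact pcomp_congr (by omega) (by omega) _ _ _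
  have h₃ : ∑ i ∈ Finset.Ico (a + 1) n, ∑ j ∈ Finset.Ico (i + p - 1 + 1) (n + p - 1),
      pcomp r (j + m - 1) (pcomp (n + p - 1 + m - 1) (i + p - 1) (pcomp (n + p - 1) a f u) g) h =
      ∑ i ∈ Finset.Ico (a + 1) n, ∑ j ∈ Finset.Ico (i + 1) n, tripleTerm r a i j f u g h := by
    refine Finset.sum_congr rfl fun i hi => ?_
    have hi := Finset.mem_Ico.1 hi
    rw [show i + p - 1 + 1 = i + 1 + p - 1 by omega, ← sum_Ico_add_sub_one (Nat.succ_pos i)]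
    rfl
  rw [Finset.sum_congr rfl h₁, h₂, h₃]
  simp only [Finset.sum_add_distrib, ← Finset.smul_sum]
  abel

/-- The braces of `(f ∘ u){g, h}`. -/
theorem brace_tcirc {n m l p r : ℕ} (hr : n + m + l + p = r + 3)
    (f : Cochain k A n) (u : Cochain k A p) (g : Cochain k A m) (h : Cochain k A l) :
    brace r (tcirc (n + p - 1) f u) g h =
      tcirc r f (brace (p + m - 1 + l - 1) u g h) +
      brace r f (tcirc (p + m - 1) u g) h +
      (-1 : k) ^ ((m + 1) * (p + 1)) • brace r f g (tcirc (p + l - 1) u h) +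
      tripleBrace r f u g h + (-1 : k) ^ ((m + 1) * (p + 1)) • tripleBrace r f g u h +
      (-1 : k) ^ ((m + 1) * (p + 1)) • (-1 : k) ^ ((l + 1) * (p + 1)) •
        tripleBrace r f g h u := by
  have hb : brace r (tcirc (n + p - 1) f u) g h =
      ∑ a ∈ Finset.range n, brace r (pcomp (n + p - 1) a f u) g h := by
    simp only [brace, tcirc_apply, map_sum, LinearMap.sum_apply]
    simp only [Finset.sum_comm (t := Finset.range n)]
  rw [hb, Finset.sum_congr rfl fun a ha => brace_pcomp hr (Finset.mem_range.1 ha) f u g h]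
  simp only [Finset.sum_add_distrib, ← Finset.smul_sum]
  rw [← tcirc_apply]
  have h₁ : ∑ a ∈ Finset.range n, ∑ i ∈ Finset.range a, ∑ j ∈ Finset.Ico (i + 1) a,
      tripleTerm r i j a f g h u = tripleBrace r f g h u := by
    simp only [tripleBrace, Finset.range_eq_Ico]
    rw [← Finset.sum_Ico_Ico_comm' 0 n fun i a =>
      ∑ j ∈ Finset.Ico (i + 1) a, tripleTerm r i j a f g h u]
    refine Finset.sum_congr rfl fun i _ => ?_
    exact (Finset.sum_Ico_Ico_comm' (i + 1) n fun j a => tripleTerm r i j a f g h u).symm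
  have h₂ : ∑ a ∈ Finset.range n, ∑ i ∈ Finset.range a, pcomp r (a + m - 1)
      (pcomp (n + m - 1) i f g) (tcirc (p + l - 1) u h) = brace r f g (tcirc (p + l - 1) u h) := by
    simp only [brace, Finset.range_eq_Ico]
    exact (Finset.sum_Ico_Ico_comm' 0 n fun i a => pcomp r (a + m - 1)
      (pcomp (n + m - 1) i f g) (tcirc (p + l - 1) u h)).symm
  have h₃ : ∑ a ∈ Finset.range n, ∑ i ∈ Finset.range a, ∑ j ∈ Finset.Ico (a + 1) n,
      tripleTerm r i a j f g u h = tripleBrace r f g u h := by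
    simp only [tripleBrace, Finset.range_eq_Ico]
    exact (Finset.sum_Ico_Ico_comm' 0 n fun i a =>
      ∑ j ∈ Finset.Ico (a + 1) n, tripleTerm r i a j f g u h).symm
  rw [h₁, h₂, h₃, brace, tripleBrace]
  abel

end Operad

/-! ### The multiplication, the bracket, and the homotopies behind the Gerstenhaber identities. -/

section Operad

variable {k A : Type*} [CommRing k] [CommRing A] [Algebra k A]

/-! ### Compositions and braces with free intermediate degrees -/

/-- Intermediate degrees become variables, so that the identity applies where they appear as `p + 1`
or `3` rather than as differences. -/
theorem tcirc_tcirc' {n m l s t r : ℕ} (hr : n + m + l = r + 2) (hs : s = n + m - 1)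
    (ht : t = m + l - 1) (f : Cochain k A n) (g : Cochain k A m) (h : Cochain k A l) :
    tcirc r (tcirc s f g) h = tcirc r f (tcirc t g h) + brace r f g h +
      (-1 : k) ^ ((m + 1) * (l + 1)) • brace r f h g := by
  subst hs ht
  exact tcirc_tcirc hr f g h

theorem tcirc_brace' {n m l p s t₁ t₂ r : ℕ} (hr : n + m + l + p = r + 3)
    (hs : s = n + m - 1 + l - 1) (ht₁ : t₁ = l + p - 1) (ht₂ : t₂ = m + p - 1)
    (f : Cochain k A n) (g : Cochain k A m) (h : Cochain k A l) (u : Cochain k A p) :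
    tcirc r (brace s f g h) u =
      brace r f g (tcirc t₁ h u) +
      (-1 : k) ^ ((l + 1) * (p + 1)) • brace r f (tcirc t₂ g u) h +
      tripleBrace r f g h u + (-1 : k) ^ ((l + 1) * (p + 1)) • tripleBrace r f g u h +
      (-1 : k) ^ ((l + 1) * (p + 1)) • (-1 : k) ^ ((m + 1) * (p + 1)) •
        tripleBrace r f u g h := by
  subst hs ht₁ ht₂
  exact tcirc_brace hr f g h u

theorem brace_tcirc' {n m l p s t t₁ t₂ r : ℕ} (hr : n + m + l + p = r + 3)
    (hs : s = n + p - 1) (ht : t = p + m - 1 + l - 1) (ht₁ : t₁ = p + m - 1) (ht₂ : t₂ = p + l - 1)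
    (f : Cochain k A n) (u : Cochain k A p) (g : Cochain k A m) (h : Cochain k A l) :
    brace r (tcirc s f u) g h =
      tcirc r f (brace t u g h) + brace r f (tcirc t₁ u g) h +
      (-1 : k) ^ ((m + 1) * (p + 1)) • brace r f g (tcirc t₂ u h) +
      tripleBrace r f u g h + (-1 : k) ^ ((m + 1) * (p + 1)) • tripleBrace r f g u h +
      (-1 : k) ^ ((m + 1) * (p + 1)) • (-1 : k) ^ ((l + 1) * (p + 1)) •
        tripleBrace r f g h u := by
  subst hs ht ht₁ ht₂
  exact brace_tcirc hr f u g h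

theorem brace_smul_left {n m l r : ℕ} (c : k) (f : Cochain k A n) (g : Cochain k A m)
    (h : Cochain k A l) : brace r (c • f) g h = c • brace r f g h := by
  simp only [brace, map_smul, LinearMap.smul_apply, Finset.smul_sum]

theorem brace_smul_mid {n m l r : ℕ} (c : k) (f : Cochain k A n) (g : Cochain k A m)
    (h : Cochain k A l) : brace r f (c • g) h = c • brace r f g h := by
  simp only [brace, map_smul, LinearMap.smul_apply, Finset.smul_sum]

theorem brace_smul_right {n m l r : ℕ} (c : k) (f : Cochain k A n) (g : Cochain k A m)
    (h : Cochain k A l) : brace r f g (c • h) = c • brace r f g h := by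
  simp only [brace, map_smul, Finset.smul_sum]

theorem brace_eq_zero {n m l r : ℕ} (hn : n < 2) (f : Cochain k A n) (g : Cochain k A m)
    (h : Cochain k A l) : brace r f g h = 0 := by
  refine Finset.sum_eq_zero fun i hi => ?_
  have := Finset.mem_range.1 hi
  rw [Finset.Ico_eq_empty (by omega), Finset.sum_empty]

theorem tripleBrace_eq_zero {n m l p r : ℕ} (hn : n < 3) (f : Cochain k A n) (g : Cochain k A m)
    (h : Cochain k A l) (u : Cochain k A p) : tripleBrace r f g h u = 0 := by
  refine Finset.sum_eq_zero fun i hi => Finset.sum_eq_zero fun j hj => ?_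
  have := Finset.mem_Ico.1 hj
  rw [Finset.Ico_eq_empty (by omega), Finset.sum_empty]

/-! ### The multiplication -/

/-- Pullback only regroups the factors of the full product. Since 𝔪 is such a product, so are all
its partial composites. -/
theorem pull_mkPiAlgebra {V W : Type*} [Fintype V] [Fintype W] [DecidableEq W] (φ : V → W) :
    pull φ (MultilinearMap.mkPiAlgebra k W A) = MultilinearMap.mkPiAlgebra k V A := by
  ext a
  simp [pull_apply, Finset.prod_fiberwise]

theorem sumMul_mkPiAlgebra {V W : Type*} [Fintype V] [Fintype W] :
    sumMul (MultilinearMap.mkPiAlgebra k V A) (MultilinearMap.mkPiAlgebra k W A) =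
      MultilinearMap.mkPiAlgebra k (V ⊕ W) A := by
  ext a
  simp [sumMul_apply]

/-- Both unsigned composites are the product of all three entries; only the composite at the second
input carries the sign -1. -/
theorem pcomp_mult_mult : pcomp 3 1 (mult k A) (mult k A) = -pcomp 3 0 (mult k A) (mult k A) := by
  rw [pcomp_eq (by norm_num) (by norm_num), pcomp_eq (by norm_num) (by norm_num)]
  simp only [comp, mult, sumMul_mkPiAlgebra, pull_mkPiAlgebra]
  norm_num
  module

theorem tcirc_mult_mult : tcirc 3 (mult k A) (mult k A) = 0 := by
  simp [tcirc_apply, Finset.sum_range_succ, pcomp_mult_mult]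

/-- The brace `𝔪{f, g}` as a bilinear map. -/
def mulBrace {n m : ℕ} (r : ℕ) : Cochain k A n →ₗ[k] Cochain k A m →ₗ[k] Cochain k A r :=
  pcomp r n ∘ₗ pcomp (n + 1) 0 (mult k A)

theorem mulBrace_apply {n m r : ℕ} (f : Cochain k A n) (g : Cochain k A m) :
    mulBrace r f g = pcomp r n (pcomp (n + 1) 0 (mult k A) f) g := rfl

theorem brace_mult {n m r : ℕ} (f : Cochain k A n) (g : Cochain k A m) :
    brace r (mult k A) f g = mulBrace r f g := by
  rw [brace, Finset.sum_range_succ, Finset.sum_range_one, mulBrace_apply]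
  simp only [zero_add, Nat.Ico_succ_singleton, Finset.sum_singleton, Nat.reduceAdd,
    Finset.Ico_self, Finset.sum_empty, add_zero]
  exact pcomp_congr (by omega) (by omega) _ _ _

/-- The two forms insert `f` and `g` into 𝔪 in opposite orders, and the parallel axiom compares
them. -/
theorem multBrace_eq {n m r : ℕ} (h : n + m = r) (f : Cochain k A n) (g : Cochain k A m) :
    multBrace h f g = mulBrace r f g := by
  have e := pcomp_right_comm (s := n + 1) (t := m + 1) (r := r) (i := 0) (j := 1) (by omega)
    (by omega) (by omega) one_pos one_lt_two (mult k A) f g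
  rw [pcomp_eq (n := 2) (m := m) (r := m + 1) (by omega) one_lt_two, map_smul,
    LinearMap.smul_apply, pcomp_eq (i := 0) (n := m + 1) (by omega) (by omega), smul_smul,
    smul_smul, ← pow_add, ← pow_add, Nat.add_sub_cancel_left] at e
  rw [mulBrace_apply, e, multBrace]
  congr 1
  apply neg_one_pow_congr
  push_cast
  generalize (n : ZMod 2) = a, (m : ZMod 2) = b
  revert a b
  decide

theorem cup_eq {n m r : ℕ} (h : n + m = r) (f : Cochain k A n) (g : Cochain k A m) :
    cup h f g = (-1 : k) ^ n • mulBrace r f g := by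
  rw [cup, multBrace_eq]

/-- Both sides unfold to `f`, `g`, `h` inserted into a composite of two copies of 𝔪, at its second
input on the left and at its first on the right; `pcomp_mult_mult` identifies these. The remaining
sign is absorbed by that of the cup product. -/
theorem mulBrace_assoc {p q s a b r : ℕ} (ha : p + q = a) (hb : q + s = b) (hr : p + q + s = r)
    (f : Cochain k A p) (g : Cochain k A q) (h : Cochain k A s) :
    mulBrace r f (mulBrace b g h) = (-1 : k) ^ p • mulBrace r (mulBrace a f g) h := by
  have e₁ : pcomp r p (pcomp (p + 1) 0 (mult k A) f) (mulBrace b g h) = pcomp r (p + q)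
      (pcomp (p + q + 1) p (pcomp (p + 1) 0 (mult k A) f) (pcomp (q + 1) 0 (mult k A) g)) h :=
    (pcomp_pcomp (by omega) (by omega) (by omega) (by omega) (by omega) _ _ _).symm
  have e₂ : pcomp (p + q + 1) p (pcomp (p + 1) 0 (mult k A) f) (pcomp (q + 1) 0 (mult k A) g) =
      pcomp (p + q + 1) (p + 0) (pcomp (p + 2) p (pcomp (p + 1) 0 (mult k A) f) (mult k A)) g :=
    (pcomp_pcomp (by omega) (by omega) (by omega) (by omega) (by omega) _ _ _).symm
  have e₃ : pcomp (p + 2) (1 + p - 1) (pcomp (p + 1) 0 (mult k A) f) (mult k A) =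
      (-1 : k) ^ ((p + 1) * (2 + 1)) • pcomp (p + 2) 0 (pcomp 3 1 (mult k A) (mult k A)) f :=
    pcomp_right_comm (by omega) (by omega) (by omega) (by omega) (by omega) _ _ _
  have e₄ : pcomp (p + q + 1) 0 (mult k A) (mulBrace a f g) = pcomp (p + q + 1) (0 + p)
      (pcomp (p + 2) 0 (mult k A) (pcomp (p + 1) 0 (mult k A) f)) g :=
    (pcomp_pcomp (by omega) (by omega) (by omega) (by omega) (by omega) _ _ _).symm
  have e₅ : pcomp (p + 2) 0 (mult k A) (pcomp (p + 1) 0 (mult k A) f) =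
      pcomp (p + 2) (0 + 0) (pcomp 3 0 (mult k A) (mult k A)) f :=
    (pcomp_pcomp (by omega) (by omega) (by omega) (by omega) (by omega) _ _ _).symm
  have hs : (-1 : k) ^ ((p + 1) * (2 + 1)) = -(-1) ^ p := by
    rw [← neg_one_mul ((-1 : k) ^ p), ← pow_succ']
    apply neg_one_pow_congr
    push_cast
    generalize (p : ZMod 2) = a
    revert a
    decide
  subst ha
  rw [Nat.add_sub_cancel_left, pcomp_mult_mult, map_neg, LinearMap.neg_apply, hs,
    neg_smul_neg] at e₃
  rw [mulBrace_apply f, e₁, e₂, add_zero, e₃, map_smul, LinearMap.smul_apply, map_smul,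
    LinearMap.smul_apply, mulBrace_apply _ h, e₄, e₅, zero_add, zero_add]

/-! ### The bracket and the differential -/

/-- The bracket `[f, g]`, zero unless `r = n + m - 1`. -/
def tbracket {n m : ℕ} (r : ℕ) : Cochain k A n →ₗ[k] Cochain k A m →ₗ[k] Cochain k A r :=
  tcirc r + -(-1 : k) ^ ((n + 1) * (m + 1)) • (tcirc r).flip

theorem tbracket_apply {n m r : ℕ} (f : Cochain k A n) (g : Cochain k A m) :
    tbracket r f g = tcirc r f g - (-1 : k) ^ ((n + 1) * (m + 1)) • tcirc r g f := by
  change tcirc r f g + -(-1 : k) ^ ((n + 1) * (m + 1)) • tcirc r g f = _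
  module

theorem tbracket_eq {n m r : ℕ} (h : n + m = r + 1) (f : Cochain k A n) (g : Cochain k A m) :
    tbracket r f g = bracket h f g := by
  rw [tbracket_apply, bracket, tcirc_eq, tcirc_eq]

theorem opDiff_eq {n : ℕ} (f : Cochain k A n) :
    opDiff f = tcirc (n + 1) (mult k A) f - (-1 : k) ^ (n + 1) • tcirc (n + 1) f (mult k A) := by
  rw [opDiff, tcirc_eq, tcirc_eq]

theorem opDiff_eq_tbracket {n : ℕ} (f : Cochain k A n) :
    opDiff f = tbracket (n + 1) (mult k A) f := by
  rw [opDiff_eq, tbracket_apply]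
  congr 2
  apply neg_one_pow_congr
  push_cast
  generalize (n : ZMod 2) = a
  revert a
  decide

/-- The outer sign uses `q + s` instead of `t + 1`, so the formula needs no degree hypothesis: when
these differ, everything is zero. -/
theorem tbracket_tbracket_right {p q s t r : ℕ} (f : Cochain k A p) (g : Cochain k A q)
    (h : Cochain k A s) :
    tbracket r f (tbracket t g h) = tcirc r f (tcirc t g h) -
      (-1 : k) ^ ((q + 1) * (s + 1)) • tcirc r f (tcirc t h g) -
      (-1 : k) ^ ((p + 1) * (q + s)) • (tcirc r (tcirc t g h) f -
      (-1 : k) ^ ((q + 1) * (s + 1)) • tcirc r (tcirc t h g) f) := by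
  by_cases h₀ : q + s = t + 1
  · simp only [tbracket_apply, map_sub, map_smul, h₀]
    module
  · simp [tbracket_apply, tcirc_eq_zero h₀, tcirc_eq_zero (add_comm q s ▸ h₀)]

theorem tbracket_tbracket_left {p q s t r : ℕ} (f : Cochain k A p) (g : Cochain k A q)
    (h : Cochain k A s) :
    tbracket r (tbracket t f g) h = tcirc r (tcirc t f g) h -
      (-1 : k) ^ ((p + 1) * (q + 1)) • tcirc r (tcirc t g f) h -
      (-1 : k) ^ ((p + q) * (s + 1)) • (tcirc r h (tcirc t f g) -
      (-1 : k) ^ ((p + 1) * (q + 1)) • tcirc r h (tcirc t g f)) := by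
  by_cases h₀ : p + q = t + 1
  · simp only [tbracket_apply, map_sub, map_smul, LinearMap.sub_apply, LinearMap.smul_apply, h₀]
    module
  · simp [tbracket_apply, tcirc_eq_zero h₀, tcirc_eq_zero (add_comm p q ▸ h₀)]

/-- The six orders of the pre-Lie identity rewrite every associator by braces, and the braces cancel
in pairs. Parity cases on the three degrees make the cancellation linear. -/
theorem tbracket_jacobi {p q s t₁ t₂ t₃ r : ℕ} (hr : p + q + s = r + 2) (ht₁ : t₁ = q + s - 1)
    (ht₂ : t₂ = p + q - 1) (ht₃ : t₃ = p + s - 1) (f : Cochain k A p) (g : Cochain k A q)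
    (h : Cochain k A s) :
    tbracket r f (tbracket t₁ g h) = tbracket r (tbracket t₂ f g) h +
      (-1 : k) ^ ((p + 1) * (q + 1)) • tbracket r g (tbracket t₃ f h) := by
  have e₁ := tcirc_tcirc' (r := r) (s := t₂) (t := t₁) (by omega) (by omega) (by omega) f g h
  have e₂ := tcirc_tcirc' (r := r) (s := t₃) (t := t₁) (by omega) (by omega) (by omega) f h g
  have e₃ := tcirc_tcirc' (r := r) (s := t₂) (t := t₃) (by omega) (by omega) (by omega) g f h
  have e₄ := tcirc_tcirc' (r := r) (s := t₁) (t := t₃) (by omega) (by omega) (by omega) g h f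
  have e₅ := tcirc_tcirc' (r := r) (s := t₃) (t := t₂) (by omega) (by omega) (by omega) h f g
  have e₆ := tcirc_tcirc' (r := r) (s := t₁) (t := t₂) (by omega) (by omega) (by omega) h g f
  rw [tbracket_tbracket_left, tbracket_tbracket_right, tbracket_tbracket_right,
    e₁, e₂, e₃, e₄, e₅, e₆]
  rcases neg_one_pow_eq_or k p with hp | hp <;> rcases neg_one_pow_eq_or k q with hq | hq <;>
    rcases neg_one_pow_eq_or k s with hs | hs <;>
    simp only [pow_mul, pow_add, pow_one, hp, hq, hs, mul_one, mul_neg, neg_neg,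
      one_pow, one_smul] <;>
    module

theorem tbracket_skew {p q r : ℕ} (f : Cochain k A p) (g : Cochain k A q) :
    tbracket r f g = -((-1 : k) ^ ((p + 1) * (q + 1)) • tbracket r g f) := by
  rw [tbracket_apply, tbracket_apply]
  rcases neg_one_pow_eq_or k p with hp | hp <;> rcases neg_one_pow_eq_or k q with hq | hq <;>
    simp only [pow_mul, pow_add, pow_one, hp, hq, mul_one, mul_neg, neg_neg, one_pow] <;>
    module

theorem opDiff_tbracket {p q r : ℕ} (hr : p + q = r + 1) (f : Cochain k A p) (g : Cochain k A q) :
    opDiff (tbracket r f g) = tbracket (r + 1) (opDiff f) g -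
      (-1 : k) ^ p • tbracket (r + 1) f (opDiff g) := by
  rw [opDiff_eq_tbracket, opDiff_eq_tbracket, opDiff_eq_tbracket,
    tbracket_jacobi (t₁ := r) (t₂ := p + 1) (t₃ := q + 1) (by omega) (by omega) (by omega)
      (by omega), sub_eq_add_neg]
  congr 1
  rcases neg_one_pow_eq_or k p with hp | hp <;>
    simp only [pow_mul, pow_add, pow_one, hp, neg_one_sq, mul_one, mul_neg, neg_neg] <;>
    module

/-- Jacobi would give only twice this identity, which is not enough in characteristic 2. The pre-Lie
identity gives it directly from 𝔪 ∘ 𝔪 = 0; in `e₃` the two copies of f{𝔪, 𝔪} cancel. -/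
theorem opDiff_opDiff {p : ℕ} (f : Cochain k A p) : opDiff (opDiff f) = 0 := by
  have e₁ := tcirc_tcirc' (r := p + 2) (s := p + 1) (t := p + 1) (by omega) (by omega) (by omega)
    (mult k A) f (mult k A)
  have e₂ := tcirc_tcirc' (r := p + 2) (s := 3) (t := p + 1) (by omega) (by omega) (by omega)
    (mult k A) (mult k A) f
  have e₃ := tcirc_tcirc' (r := p + 2) (s := p + 1) (t := 3) (by omega) (by omega) (by omega)
    f (mult k A) (mult k A)
  rw [tcirc_mult_mult] at e₂ e₃
  simp only [map_zero, LinearMap.zero_apply, zero_add] at e₂ e₃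
  rw [opDiff_eq, opDiff_eq]
  simp only [map_sub, map_smul, LinearMap.sub_apply, LinearMap.smul_apply]
  rw [e₁, e₃]
  rw [add_assoc, eq_comm, ← eq_neg_iff_add_eq_zero] at e₂
  rw [e₂]
  rcases neg_one_pow_eq_or k p with hp | hp <;>
    simp only [pow_mul, pow_add, pow_one, hp, neg_one_sq, mul_one, mul_neg, neg_neg, one_pow] <;>
    module

/-- The differential is a derivation of the brace `𝔪{f, g}`. -/
theorem opDiff_mulBrace {p q r : ℕ} (hr : p + q = r) (f : Cochain k A p) (g : Cochain k A q) :
    opDiff (mulBrace r f g) =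
      (-1 : k) ^ p • mulBrace (r + 1) f (opDiff g) - mulBrace (r + 1) (opDiff f) g := by
  have e₁ := tcirc_brace' (s := r) (t₁ := q + 1) (t₂ := p + 1) (r := r + 1) (by omega) (by omega)
    (by omega) (by omega) (mult k A) f g (mult k A)
  have e₂ := brace_tcirc' (s := 3) (t := r) (t₁ := p + 1) (t₂ := q + 1) (r := r + 1) (by omega)
    (by omega) (by omega) (by omega) (by omega) (mult k A) (mult k A) f g
  have e₃ := brace_smul_left (r := r + 1) (0 : k) (0 : Cochain k A 3) f g
  rw [zero_smul, zero_smul] at e₃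
  -- Triple braces of 𝔪 vanish since it has only two inputs, and the left side of `e₂` is zero
  -- because 𝔪 ∘ 𝔪 is.
  simp only [tripleBrace_eq_zero (show 2 < 3 by omega), brace_mult, smul_zero, add_zero,
    tcirc_mult_mult, e₃] at e₁ e₂
  rw [add_assoc, eq_comm, ← eq_neg_iff_add_eq_zero] at e₂
  simp only [opDiff_eq, map_sub, map_smul, LinearMap.sub_apply, LinearMap.smul_apply]
  rw [e₁, e₂]
  subst hr
  rcases neg_one_pow_eq_or k p with hp | hp <;> rcases neg_one_pow_eq_or k q with hq | hq <;>
    simp only [pow_mul, pow_add, pow_one, hp, hq, neg_one_sq, mul_one, mul_neg, neg_neg, one_pow] <;>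
    module

/-- The failure of `𝔪{f, g}` to be graded commutative is a coboundary, for cocycles `f`, `g`. -/
theorem mulBrace_comm {p q r t : ℕ} (hr : p + q = r) (ht : t = p + q - 1) (f : Cochain k A p)
    (g : Cochain k A q) (hf : opDiff f = 0) (hg : opDiff g = 0) :
    mulBrace r f g + (-1 : k) ^ ((p + 1) * (q + 1)) • mulBrace r g f =
      (-1 : k) ^ (p + q) • tcirc r (tcirc t f g) (mult k A) -
        tcirc r (mult k A) (tcirc t f g) := by
  have e₁ := tcirc_tcirc' (r := r) (s := p + 1) (t := t) (by omega) (by omega) (by omega)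
    (mult k A) f g
  have e₂ := tcirc_tcirc' (r := r) (s := p + 1) (t := q + 1) (by omega) (by omega) (by omega)
    f (mult k A) g
  have e₃ := tcirc_tcirc' (r := r) (s := t) (t := q + 1) (by omega) (by omega) (by omega)
    f g (mult k A)
  rw [opDiff_eq, sub_eq_zero] at hf hg
  rw [brace_mult, brace_mult] at e₁
  -- The cocycle conditions turn 𝔪 ∘ f into ± f ∘ 𝔪, and then 𝔪 ∘ g into ± g ∘ 𝔪; by `e₃` the braces
  -- of `f` with `g` and 𝔪 then cancel.
  rw [hf, map_smul, LinearMap.smul_apply, e₂, hg, map_smul, eq_comm, add_assoc] at e₁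
  rw [eq_sub_iff_add_eq', e₁, e₃]
  rcases neg_one_pow_eq_or k p with hp | hp <;> rcases neg_one_pow_eq_or k q with hq | hq <;>
    simp only [pow_mul, pow_add, pow_one, hp, hq, neg_one_sq, mul_one, mul_neg, neg_neg, one_pow] <;>
    module

/-- The failure of `[f, -]` to be a derivation of the cup product is a coboundary, for cocycles. -/
theorem tbracket_mulBrace {p q s t t₁ t₂ t₃ r : ℕ} (hr : p + q + s = r + 1) (ht : q + s = t)
    (ht₁ : t₁ = p + q - 1) (ht₂ : t₂ = p + s - 1) (ht₃ : t₃ = p + q - 1 + s - 1)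
    (f : Cochain k A p) (g : Cochain k A q) (h : Cochain k A s) (hf : opDiff f = 0)
    (hg : opDiff g = 0) (hh : opDiff h = 0) :
    tbracket r f (mulBrace t g h) =
      (-1 : k) ^ (p + 1) • mulBrace r (tbracket t₁ f g) h +
      (-1 : k) ^ ((p + 1) * q) • mulBrace r g (tbracket t₂ f h) +
      (-1 : k) ^ (p + 1) • (tcirc r (mult k A) (brace t₃ f g h) -
        (-1 : k) ^ (p + q + s + 1) • tcirc r (brace t₃ f g h) (mult k A)) := by
  have e₁ := tcirc_brace' (s := t) (t₁ := t₂) (t₂ := t₁) (r := r) (by omega) (by omega)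
    (by omega) (by omega) (mult k A) g h f
  have e₂ := brace_tcirc' (s := p + 1) (t := t₃) (t₁ := t₁) (t₂ := t₂) (r := r) (by omega)
    (by omega) (by omega) (by omega) (by omega) (mult k A) f g h
  have e₃ := brace_tcirc' (s := p + 1) (t := t) (t₁ := q + 1) (t₂ := s + 1) (r := r) (by omega)
    (by omega) (by omega) (by omega) (by omega) f (mult k A) g h
  have e₄ := tcirc_brace' (s := t₃) (t₁ := s + 1) (t₂ := q + 1) (r := r) (by omega) (by omega)
    (by omega) (by omega) f g h (mult k A)
  rw [opDiff_eq, sub_eq_zero] at hf hg hh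
  simp only [tripleBrace_eq_zero (show 2 < 3 by omega), brace_mult, smul_zero, add_zero] at e₁ e₂
  -- The cocycle conditions exchange 𝔪 with `f`, `g` and `h` in turn; the triple braces of `f` from
  -- `e₃` and `e₄` cancel at the end.
  rw [hf, brace_smul_left, e₃, hg, hh, brace_smul_mid, brace_smul_right, brace_mult, eq_comm,
    add_assoc, ← eq_sub_iff_add_eq] at e₂
  subst ht
  rw [e₂, e₄, tbracket_apply, e₁]
  simp only [tbracket_apply, map_sub, map_smul, LinearMap.sub_apply, LinearMap.smul_apply]
  rcases neg_one_pow_eq_or k p with hp | hp <;> rcases neg_one_pow_eq_or k q with hq | hq <;>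
    rcases neg_one_pow_eq_or k s with hs | hs <;>
    simp only [pow_mul, pow_add, pow_one, hp, hq, hs, neg_one_sq, mul_one, mul_neg, neg_neg,
      one_pow] <;>
    module

end Operad

/-! ### Comparison with the simplicial differential. -/

section Differential

variable {k A : Type*} [CommRing k] [CommRing A] [Algebra k A]

/-- Multiplying by the entry of 𝔪 is the same as sending its position to the base point. Partial
compositions with 𝔪 thus become pointed pullbacks. -/
theorem sumMul_mult_left {n : ℕ} (f : Cochain k A n) :
    sumMul (mult k A) f = pull (Sum.elim (fun _ => none) some) (withCoeff f) := by
  ext a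
  rw [sumMul_apply, pull_apply]
  simp [withCoeff, mult, Finset.prod_filter]

theorem sumMul_mult_right {n : ℕ} (f : Cochain k A n) :
    sumMul f (mult k A) = pull (Sum.elim some fun _ => none) (withCoeff f) := by
  ext a
  rw [sumMul_apply, pull_apply, mul_comm]
  simp [withCoeff, mult, Finset.prod_filter]

/-- `d_0` sends exactly the first row to the base point, and this row is what lies outside the
triangle on the remaining indices. The last face does the same with the last column. -/
theorem pointedPull_face_zero {n : ℕ} (f : Cochain k A n) :
    pointedPull (face n 0) f = comp (n := 2) (by omega) 1 (mult k A) f := by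
  rw [comp, sumMul_mult_left, pull_pull]
  change pull _ (withCoeff f) = _
  congr 1
  funext v
  have hv : (v.1.1 : ℕ) < v.1.2 := v.2
  have h₀ : ((0 : Fin (n + 2)) : ℕ) = 0 := rfl
  have h₁ : ((1 : Fin 2) : ℕ) = 1 := rfl
  simp only [face, split, Function.comp]
  split_ifs <;> first
    | rfl
    | omega

theorem pointedPull_face_last {n : ℕ} (f : Cochain k A n) :
    pointedPull (face n (Fin.last (n + 1))) f = comp (n := 2) (by omega) 0 (mult k A) f := by
  rw [comp, sumMul_mult_left, pull_pull]
  change pull _ (withCoeff f) = _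
  congr 1
  funext v
  have hv : (v.1.1 : ℕ) < v.1.2 := v.2
  have hn := v.1.2.2
  simp only [face, split, Function.comp, Fin.val_zero, Fin.val_last]
  rw [dif_neg (by omega), dif_neg (by omega)]
  by_cases h : (v.1.2 : ℕ) = n
  · rw [dif_pos h, dif_neg (by omega)]
    rfl
  · rw [dif_neg h, dif_pos (by omega)]
    rfl

/-- An inner face sends only the position `(i, i + 1)` to the base point, which is the triangle fed
to 𝔪, and merges the indices `i` and `i + 1` elsewhere. -/
theorem pointedPull_face_succ {n : ℕ} (i : Fin n) (f : Cochain k A n) :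
    pointedPull (face n i.castSucc.succ) f = comp (by omega) i f (mult k A) := by
  rw [comp, sumMul_mult_right, pull_pull]
  change pull _ (withCoeff f) = _
  congr 1
  funext v
  have hv : (v.1.1 : ℕ) < v.1.2 := v.2
  have hn := v.1.2.2
  simp only [face, split, Function.comp, Fin.val_succ, Fin.val_castSucc]
  by_cases hb : (i : ℕ) ≤ v.1.1 ∧ (v.1.2 : ℕ) < i + 2
  · rw [dif_pos hb, dif_neg (by omega), dif_pos (by omega), dif_pos (by omega)]
    rfl
  · rw [dif_neg hb]
    split_ifs <;> first
      | omega
      | simp only [Sum.elim_inl, Option.some.injEq, Subtype.mk.injEq, Prod.mk.injEq, Fin.mk.injEq,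
          collapse]
        constructor <;> split_ifs <;> omega

theorem delta_eq (n : ℕ) (f : Cochain k A n) :
    delta k A n f = (-1 : k) ^ (n + 1) • opDiff f := by
  have h₁ : delta k A n f = ∑ i : Fin (n + 2), (-1 : k) ^ (i : ℕ) • pointedPull (face n i) f := by
    simp [delta]
  have h₂ : circ (r := n + 1) (by omega) (mult k A) f = comp (n := 2) (by omega) 0 (mult k A) f +
      (-1 : k) ^ (n + 1) • comp (n := 2) (by omega) 1 (mult k A) f := by
    simp [circ]
  have h₃ : circ (r := n + 1) (by omega) f (mult k A) =
      ∑ i : Fin n, (-1 : k) ^ (i : ℕ) • comp (by omega) i f (mult k A) := by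
    refine Finset.sum_congr rfl fun i _ => ?_
    rw [mul_comm, pow_mul]
    norm_num
  have h₄ : ∑ i : Fin n, (-1 : k) ^ (i.castSucc.succ : ℕ) •
      pointedPull (face n i.castSucc.succ) f =
      -∑ i : Fin n, (-1 : k) ^ (i : ℕ) • comp (by omega) i f (mult k A) := by
    rw [← Finset.sum_neg_distrib]
    refine Finset.sum_congr rfl fun i _ => ?_
    rw [pointedPull_face_succ, Fin.val_succ, Fin.val_castSucc, pow_succ]
    module
  rw [h₁, Fin.sum_univ_succ, Fin.sum_univ_castSucc, opDiff, h₂, h₃, h₄, pointedPull_face_zero,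
    Fin.succ_last, pointedPull_face_last, Fin.val_zero, Fin.val_last, pow_zero, pow_succ]
  rcases neg_one_pow_eq_or k n with hn | hn <;> rw [hn] <;> module

theorem delta_delta (n : ℕ) (f : Cochain k A n) : delta k A (n + 1) (delta k A n f) = 0 := by
  rw [delta_eq n, map_smul, delta_eq, opDiff_opDiff, smul_zero, smul_zero]

theorem mem_cocycles_iff {n : ℕ} {f : Cochain k A n} : f ∈ cocycles k A n ↔ opDiff f = 0 := by
  rw [LinearMap.mem_ker, delta_eq]
  refine ⟨fun h => ?_, fun h => by rw [h, smul_zero]⟩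
  have := congrArg ((-1 : k) ^ (n + 1) • ·) h
  simpa only [smul_smul, ← pow_add, Even.neg_one_pow ⟨_, rfl⟩, one_smul, smul_zero] using this

theorem opDiff_mem_coboundaries {n : ℕ} (f : Cochain k A n) :
    opDiff f ∈ coboundaries k A (n + 1) := by
  refine ⟨(-1 : k) ^ (n + 1) • f, ?_⟩
  rw [map_smul, delta_eq, smul_smul, ← pow_add, Even.neg_one_pow ⟨_, rfl⟩, one_smul]

/-- Treats degree 0, where only zero is a coboundary, together with images of the differential. The
predicate ranges over all degrees because the target degree of an operation moves along. -/
theorem coboundaries_induction {P : ∀ n, Cochain k A n → Prop} (h₀ : P 0 0)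
    (h₁ : ∀ n (f : Cochain k A n), P (n + 1) (opDiff f)) {n : ℕ} {f : Cochain k A n}
    (hf : f ∈ coboundaries k A n) : P n f := by
  rcases n with _ | n
  · rw [(Submodule.mem_bot k).1 hf]
    exact h₀
  · obtain ⟨g, rfl⟩ := hf
    have : delta k A n g = opDiff ((-1 : k) ^ (n + 1) • g) := by
      rw [delta_eq, opDiff_eq_tbracket, opDiff_eq_tbracket, map_smul]
    rw [this]
    exact h₁ n _

end Differential

/-! ### Bilinear maps on subquotients and on direct sums. -/

section Descent

variable {k : Type*} [CommRing k]

section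

variable {M₁ M₂ M₃ : Type*} [AddCommGroup M₁] [AddCommGroup M₂] [AddCommGroup M₃]
  [Module k M₁] [Module k M₂] [Module k M₃] {Z₁ B₁ : Submodule k M₁} {Z₂ B₂ : Submodule k M₂}
  {Z₃ B₃ : Submodule k M₃}

theorem Subquotient.mk_surjective : Function.Surjective (Subquotient.mk Z₁ B₁) :=
  Submodule.mkQ_surjective _

theorem Subquotient.mk_eq_zero {f : Z₁} (h : f.1 ∈ B₁) : Subquotient.mk Z₁ B₁ f = 0 :=
  (Submodule.Quotient.mk_eq_zero (B₁.submoduleOf Z₁)).2 h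

/-- The bilinear map of subquotients induced by a bilinear map. -/
def Subquotient.map₂ (φ : M₁ →ₗ[k] M₂ →ₗ[k] M₃) (hZ : ∀ f ∈ Z₁, ∀ g ∈ Z₂, φ f g ∈ Z₃)
    (hl : ∀ f ∈ B₁, ∀ g ∈ Z₂, φ f g ∈ B₃) (hr : ∀ f ∈ Z₁, ∀ g ∈ B₂, φ f g ∈ B₃) :
    Subquotient Z₁ B₁ →ₗ[k] Subquotient Z₂ B₂ →ₗ[k] Subquotient Z₃ B₃ :=
  (B₁.submoduleOf Z₁).liftQ
    { toFun := fun f => (B₂.submoduleOf Z₂).liftQ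
        (Subquotient.mk Z₃ B₃ ∘ₗ
          ((φ f.1).domRestrict Z₂).codRestrict Z₃ fun g => hZ f.1 f.2 g.1 g.2)
        fun g hg => Subquotient.mk_eq_zero (hr f.1 f.2 g.1 hg)
      map_add' := fun f f' => Submodule.linearMap_qext _ <| LinearMap.ext fun g =>
        (congrArg (Subquotient.mk Z₃ B₃) (Subtype.ext (by simp))).trans
          (map_add (Subquotient.mk Z₃ B₃) ⟨φ f.1 g.1, hZ f.1 f.2 g.1 g.2⟩
            ⟨φ f'.1 g.1, hZ f'.1 f'.2 g.1 g.2⟩)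
      map_smul' := fun c f => Submodule.linearMap_qext _ <| LinearMap.ext fun g =>
        (congrArg (Subquotient.mk Z₃ B₃) (Subtype.ext (by simp))).trans
          (map_smul (Subquotient.mk Z₃ B₃) c ⟨φ f.1 g.1, hZ f.1 f.2 g.1 g.2⟩) }
    fun f hf => LinearMap.mem_ker.2 <| Submodule.linearMap_qext _ <| LinearMap.ext fun g =>
      Subquotient.mk_eq_zero (hl f.1 hf g.1 g.2)

end

/-- The bilinear operation on a direct sum that is given by bilinear maps
`H p × H q → H (d p q)`. -/
def gradedMap₂ {H : ℕ → Type*} [∀ n, AddCommGroup (H n)] [∀ n, Module k (H n)] {d : ℕ → ℕ → ℕ}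
    (B : ∀ p q, H p →ₗ[k] H q →ₗ[k] H (d p q)) : (⨁ n, H n) →ₗ[k] (⨁ n, H n) →ₗ[k] ⨁ n, H n :=
  DirectSum.toModule k ℕ _ fun p => LinearMap.flip <| DirectSum.toModule k ℕ _ fun q =>
    LinearMap.flip <| (B p q).compr₂ (DirectSum.lof k ℕ H (d p q))

theorem gradedMap₂_lof {H : ℕ → Type*} [∀ n, AddCommGroup (H n)] [∀ n, Module k (H n)]
    {d : ℕ → ℕ → ℕ} (B : ∀ p q, H p →ₗ[k] H q →ₗ[k] H (d p q)) {p q : ℕ} (x : H p) (y : H q) :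
    gradedMap₂ B (DirectSum.lof k ℕ H p x) (DirectSum.lof k ℕ H q y) =
      DirectSum.lof k ℕ H (d p q) (B p q x y) := by
  simp [gradedMap₂]

end Descent

/-! ### Cocycles and coboundaries under the operations. -/

section Closure

variable {k A : Type*} [CommRing k] [CommRing A] [Algebra k A]

theorem tbracket_eq_zero {p q r : ℕ} (h : p + q ≠ r + 1) (f : Cochain k A p) (g : Cochain k A q) :
    tbracket r f g = 0 := by
  rw [tbracket_apply, tcirc_eq_zero h, tcirc_eq_zero (add_comm p q ▸ h), smul_zero, sub_zero]

/-- The homotopies have degree one less than `r` in truncated arithmetic; whenever truncation breaks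
this, they are zero. -/
theorem opDiff_degree_mem {t r : ℕ} (X : Cochain k A t) (h : t + 1 = r ∨ X = 0) :
    tcirc r (mult k A) X - (-1 : k) ^ r • tcirc r X (mult k A) ∈ coboundaries k A r := by
  rcases h with rfl | rfl
  · rw [← opDiff_eq]
    exact opDiff_mem_coboundaries X
  · simp

/-- The cup product as a bilinear map. -/
def cupLinear (p q r : ℕ) : Cochain k A p →ₗ[k] Cochain k A q →ₗ[k] Cochain k A r :=
  (-1 : k) ^ p • mulBrace r

theorem cupLinear_apply {p q r : ℕ} (f : Cochain k A p) (g : Cochain k A q) :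
    cupLinear p q r f g = (-1 : k) ^ p • mulBrace r f g := rfl

theorem cupLinear_eq {p q r : ℕ} (h : p + q = r) (f : Cochain k A p) (g : Cochain k A q) :
    cupLinear p q r f g = cup h f g := (cup_eq h f g).symm

theorem mulBrace_mem_cocycles {p q r : ℕ} (hr : p + q = r) {f : Cochain k A p}
    (hf : f ∈ cocycles k A p) {g : Cochain k A q} (hg : g ∈ cocycles k A q) :
    mulBrace r f g ∈ cocycles k A r := by
  rw [mem_cocycles_iff] at *
  rw [opDiff_mulBrace hr, hf, hg]
  simp

theorem mulBrace_mem_coboundaries_left {p q r : ℕ} (hr : p + q = r) {f : Cochain k A p}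
    (hf : f ∈ coboundaries k A p) {g : Cochain k A q} (hg : g ∈ cocycles k A q) :
    mulBrace r f g ∈ coboundaries k A r := by
  refine coboundaries_induction (P := fun p f => ∀ r, p + q = r →
    mulBrace r f g ∈ coboundaries k A r) (by simp) (fun n f r hr => ?_) hf r hr
  obtain rfl : r = n + q + 1 := by omega
  have h := opDiff_mulBrace rfl f g
  rw [mem_cocycles_iff.1 hg, map_zero, smul_zero, zero_sub] at h
  rw [← Submodule.neg_mem_iff, ← h]
  exact opDiff_mem_coboundaries _

theorem mulBrace_mem_coboundaries_right {p q r : ℕ} (hr : p + q = r) {f : Cochain k A p}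
    (hf : f ∈ cocycles k A p) {g : Cochain k A q} (hg : g ∈ coboundaries k A q) :
    mulBrace r f g ∈ coboundaries k A r := by
  refine coboundaries_induction (P := fun q g => ∀ r, p + q = r →
    mulBrace r f g ∈ coboundaries k A r) (by simp) (fun n g r hr => ?_) hg r hr
  obtain rfl : r = p + n + 1 := by omega
  have h := opDiff_mulBrace rfl f g
  rw [mem_cocycles_iff.1 hf, map_zero, LinearMap.zero_apply, sub_zero] at h
  have h' : mulBrace (p + n + 1) f (opDiff g) =
      (-1 : k) ^ p • opDiff (mulBrace (p + n) f g) := by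
    rw [h, smul_smul, ← pow_add, Even.neg_one_pow ⟨_, rfl⟩, one_smul]
  rw [h']
  exact Submodule.smul_mem _ _ (opDiff_mem_coboundaries _)

theorem tbracket_mem_cocycles {p q r : ℕ} {f : Cochain k A p} (hf : f ∈ cocycles k A p)
    {g : Cochain k A q} (hg : g ∈ cocycles k A q) : tbracket r f g ∈ cocycles k A r := by
  by_cases hr : p + q = r + 1
  · rw [mem_cocycles_iff] at *
    rw [opDiff_tbracket hr, hf, hg]
    simp
  · rw [tbracket_eq_zero hr]
    exact Submodule.zero_mem _

theorem tbracket_mem_coboundaries_right {p q r : ℕ} {f : Cochain k A p}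
    (hf : f ∈ cocycles k A p) {g : Cochain k A q} (hg : g ∈ coboundaries k A q) :
    tbracket r f g ∈ coboundaries k A r := by
  refine coboundaries_induction (P := fun q g => tbracket r f g ∈ coboundaries k A r)
    (by simp) (fun n g => ?_) hg
  by_cases hr : p + n = r
  · have h := tbracket_jacobi (t₁ := p + n - 1) (t₂ := p + 1) (t₃ := n + 1) (r := r) (by omega)
      (by omega) (by omega) (by omega) (mult k A) f g
    rw [← opDiff_eq_tbracket, ← opDiff_eq_tbracket, mem_cocycles_iff.1 hf, map_zero,
      LinearMap.zero_apply, zero_add] at h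
    have h' : tbracket r f (opDiff g) = (-1 : k) ^ ((2 + 1) * (p + 1)) •
        tbracket r (mult k A) (tbracket (p + n - 1) f g) := by
      rw [h, smul_smul, ← pow_add, Even.neg_one_pow ⟨_, rfl⟩, one_smul]
    rw [h']
    refine Submodule.smul_mem _ _ ?_
    -- In degree 0 the only coboundary is zero, so the bracket must vanish exactly; it does, because
    -- the inner bracket has no valid degree.
    by_cases hn : p + n = 0
    · rw [tbracket_eq_zero (by omega : p + n ≠ p + n - 1 + 1), map_zero]
      exact Submodule.zero_mem _
    · obtain rfl : r = p + n - 1 + 1 := by omega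
      rw [← opDiff_eq_tbracket]
      exact opDiff_mem_coboundaries _
  · rw [tbracket_eq_zero (by omega)]
    exact Submodule.zero_mem _

theorem tbracket_mem_coboundaries_left {p q r : ℕ} {f : Cochain k A p}
    (hf : f ∈ coboundaries k A p) {g : Cochain k A q} (hg : g ∈ cocycles k A q) :
    tbracket r f g ∈ coboundaries k A r := by
  rw [tbracket_skew]
  exact Submodule.neg_mem _ (Submodule.smul_mem _ _ (tbracket_mem_coboundaries_right hg hf))

end Closure

/-! ### The induced operations on cohomology. -/

section Cohomology

variable (k A : Type*) [CommRing k] [CommRing A] [Algebra k A]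

/-- The cup product on cohomology. -/
def cohomologyMul :
    (⨁ n, Cohomology k A n) →ₗ[k] (⨁ n, Cohomology k A n) →ₗ[k] ⨁ n, Cohomology k A n :=
  gradedMap₂ (d := fun p q => p + q) fun p q => Subquotient.map₂ (cupLinear p q (p + q))
    (fun _ hf _ hg => Submodule.smul_mem _ _ (mulBrace_mem_cocycles rfl hf hg))
    (fun _ hf _ hg => Submodule.smul_mem _ _ (mulBrace_mem_coboundaries_left rfl hf hg))
    (fun _ hf _ hg => Submodule.smul_mem _ _ (mulBrace_mem_coboundaries_right rfl hf hg))

/-- The bracket on cohomology. -/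
def cohomologyLie :
    (⨁ n, Cohomology k A n) →ₗ[k] (⨁ n, Cohomology k A n) →ₗ[k] ⨁ n, Cohomology k A n :=
  gradedMap₂ (d := fun p q => p + q - 1) fun p q => Subquotient.map₂ (tbracket (p + q - 1))
    (fun _ hf _ hg => tbracket_mem_cocycles hf hg)
    (fun _ hf _ hg => tbracket_mem_coboundaries_left hf hg)
    (fun _ hf _ hg => tbracket_mem_coboundaries_right hf hg)

variable {k A}

theorem cohomologyMul_cls {p q r : ℕ} (h : p + q = r) (f : cocycles k A p) (g : cocycles k A q) :
    cohomologyMul k A (cls k A p f) (cls k A q g) =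
      cls k A r ⟨cupLinear p q r f.1 g.1,
        Submodule.smul_mem _ _ (mulBrace_mem_cocycles h f.2 g.2)⟩ := by
  subst h
  exact gradedMap₂_lof _ _ _

theorem cohomologyLie_cls {p q r : ℕ} (h : r = p + q - 1) (f : cocycles k A p)
    (g : cocycles k A q) :
    cohomologyLie k A (cls k A p f) (cls k A q g) =
      cls k A r ⟨tbracket r f.1 g.1, tbracket_mem_cocycles f.2 g.2⟩ := by
  subst h
  exact gradedMap₂_lof _ _ _

end Cohomology

/-! ### The Gerstenhaber identities on cohomology classes. -/

section Cohomology

variable {k A : Type*} [CommRing k] [CommRing A] [Algebra k A]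

theorem cls_congr {n : ℕ} {f g : Cochain k A n} (h : f = g) (hf : f ∈ cocycles k A n) :
    cls k A n ⟨f, hf⟩ = cls k A n ⟨g, h ▸ hf⟩ := by
  subst h
  rfl

theorem cls_add {n : ℕ} (f g : cocycles k A n) : cls k A n (f + g) = cls k A n f + cls k A n g := by
  simp only [cls, map_add]

theorem cls_smul {n : ℕ} (c : k) (f : cocycles k A n) : cls k A n (c • f) = c • cls k A n f := by
  simp only [cls, map_smul]

theorem cls_eq_zero {n : ℕ} {f : Cochain k A n} (hf : f ∈ cocycles k A n)
    (h : f ∈ coboundaries k A n) : cls k A n ⟨f, hf⟩ = 0 := by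
  rw [cls, Subquotient.mk_eq_zero (f := ⟨f, hf⟩) h, map_zero]

theorem cls_eq_of_add_mem {n : ℕ} {f b : Cochain k A n} (hf : f ∈ cocycles k A n)
    (g : cocycles k A n) (hb : b ∈ coboundaries k A n) (h : f = g.1 + b) :
    cls k A n ⟨f, hf⟩ = cls k A n g := by
  have hb' : b ∈ cocycles k A n := by
    rw [← add_sub_cancel_left g.1 b, ← h]
    exact Submodule.sub_mem _ hf g.2
  have e : (⟨f, hf⟩ : cocycles k A n) = g + ⟨b, hb'⟩ := Subtype.ext h
  rw [e, cls_add, cls_eq_zero hb' hb, add_zero]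

theorem exists_cls_eq (n : ℕ) (x : Cohomology k A n) :
    ∃ f, cls k A n f = DirectSum.lof k ℕ (Cohomology k A) n x := by
  obtain ⟨f, rfl⟩ := Subquotient.mk_surjective x
  exact ⟨f, rfl⟩

theorem cls_induction {P : (⨁ n, Cohomology k A n) → Prop} (h₀ : P 0)
    (h₁ : ∀ n f, P (cls k A n f)) (h₂ : ∀ x y, P x → P y → P (x + y))
    (x : ⨁ n, Cohomology k A n) : P x := by
  induction x using DirectSum.induction_on with
  | zero => exact h₀
  | of n x =>
    obtain ⟨f, hf⟩ := exists_cls_eq n x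
    rw [← DirectSum.lof_eq_of k, ← hf]
    exact h₁ n f
  | add x y hx hy => exact h₂ x y hx hy

theorem cls_apply_of_ne {n r : ℕ} (h : r ≠ n) (f : cocycles k A n) : cls k A n f r = 0 :=
  DirectSum.of_eq_of_ne n r _ h

theorem cohomologyLie_cls_eq_zero {p q : ℕ} (h : p + q = 0) (f : cocycles k A p)
    (g : cocycles k A q) : cohomologyLie k A (cls k A p f) (cls k A q g) = 0 := by
  rw [cohomologyLie_cls rfl, cls_congr (tbracket_eq_zero (by omega) _ _),
    cls_eq_zero _ (zero_mem _)]

theorem cohomologyMul_assoc (x y z : ⨁ n, Cohomology k A n) :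
    cohomologyMul k A (cohomologyMul k A x y) z = cohomologyMul k A x (cohomologyMul k A y z) := by
  induction x using cls_induction with
  | h₀ => simp
  | h₂ x x' hx hx' => simp only [map_add, LinearMap.add_apply, hx, hx']
  | h₁ p f =>
  induction y using cls_induction with
  | h₀ => simp
  | h₂ y y' hy hy' => simp only [map_add, LinearMap.add_apply, hy, hy']
  | h₁ q g =>
  induction z using cls_induction with
  | h₀ => simp
  | h₂ z z' hz hz' => simp only [map_add, hz, hz']
  | h₁ s h =>
  rw [cohomologyMul_cls rfl, cohomologyMul_cls rfl, cohomologyMul_cls rfl,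
    cohomologyMul_cls (r := p + q + s) (by omega)]
  refine cls_congr ?_ _
  simp only [cupLinear_apply, map_smul, LinearMap.smul_apply]
  rw [mulBrace_assoc (a := p + q) rfl rfl rfl, smul_smul, smul_smul, smul_smul]
  congr 1
  rcases neg_one_pow_eq_or k p with hp | hp <;> rcases neg_one_pow_eq_or k q with hq | hq <;>
    simp [pow_add, hp, hq]

theorem cohomologyMul_comm {p q : ℕ} (f : cocycles k A p) (g : cocycles k A q) :
    cohomologyMul k A (cls k A p f) (cls k A q g) =
      (-1 : k) ^ (p * q) • cohomologyMul k A (cls k A q g) (cls k A p f) := by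
  rw [cohomologyMul_cls rfl, cohomologyMul_cls (add_comm q p), ← cls_smul]
  have hb := opDiff_degree_mem (r := p + q) (tcirc (p + q - 1) f.1 g.1) (by
    by_cases h : p + q = 0
    · exact Or.inr (tcirc_eq_zero (by omega) _ _)
    · exact Or.inl (by omega))
  -- The factor combines the cup sign `(-1)^p` with the minus sign in front of the coboundary of f ∘
  -- g.
  refine cls_eq_of_add_mem _ _ (Submodule.smul_mem _ (-(-1 : k) ^ p) hb) ?_
  have e := mulBrace_comm rfl rfl f.1 g.1 (mem_cocycles_iff.1 f.2) (mem_cocycles_iff.1 g.2)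
  rw [← eq_sub_iff_add_eq] at e
  simp only [cupLinear_apply, Submodule.coe_smul]
  rw [e]
  rcases neg_one_pow_eq_or k p with hp | hp <;> rcases neg_one_pow_eq_or k q with hq | hq <;>
    simp only [pow_mul, pow_add, pow_one, hp, hq, mul_one, mul_neg, neg_neg, one_pow] <;>
    module

theorem cohomologyLie_skew {p q : ℕ} (f : cocycles k A p) (g : cocycles k A q) :
    cohomologyLie k A (cls k A p f) (cls k A q g) =
      -((-1 : k) ^ ((p + 1) * (q + 1)) •
        cohomologyLie k A (cls k A q g) (cls k A p f)) := by
  rw [cohomologyLie_cls rfl, cohomologyLie_cls (r := p + q - 1) (by omega)]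
  have e : (-1 : k) ^ ((p + 1) * (q + 1)) • cls k A (p + q - 1)
      ⟨tbracket (p + q - 1) g.1 f.1, tbracket_mem_cocycles g.2 f.2⟩ +
      cls k A (p + q - 1) ⟨tbracket (p + q - 1) f.1 g.1, tbracket_mem_cocycles f.2 g.2⟩ = 0 := by
    rw [← cls_smul, ← cls_add]
    refine (cls_congr ?_ _).trans (cls_eq_zero (zero_mem _) (zero_mem _))
    change (-1 : k) ^ ((p + 1) * (q + 1)) • tbracket (p + q - 1) g.1 f.1 +
      tbracket (p + q - 1) f.1 g.1 = 0
    rw [tbracket_skew f.1 g.1]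
    exact add_neg_cancel _
  exact eq_neg_of_add_eq_zero_right e

theorem cohomologyLie_lie_right {p q s r : ℕ} (hr : p + q + s = r + 2) (f : cocycles k A p)
    (g : cocycles k A q) (h : cocycles k A s) :
    cohomologyLie k A (cls k A p f) (cohomologyLie k A (cls k A q g) (cls k A s h)) =
      cls k A r ⟨tbracket r f.1 (tbracket (q + s - 1) g.1 h.1),
        tbracket_mem_cocycles f.2 (tbracket_mem_cocycles g.2 h.2)⟩ := by
  by_cases hz : q + s = 0
  · rw [cohomologyLie_cls_eq_zero hz, map_zero, cls_eq_zero]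
    rw [tbracket_eq_zero (r := q + s - 1) (by omega), map_zero]
    exact zero_mem _
  · rw [cohomologyLie_cls rfl, cohomologyLie_cls (r := r) (by omega)]

theorem cohomologyLie_lie_left {p q s r : ℕ} (hr : p + q + s = r + 2) (f : cocycles k A p)
    (g : cocycles k A q) (h : cocycles k A s) :
    cohomologyLie k A (cohomologyLie k A (cls k A p f) (cls k A q g)) (cls k A s h) =
      cls k A r ⟨tbracket r (tbracket (p + q - 1) f.1 g.1) h.1,
        tbracket_mem_cocycles (tbracket_mem_cocycles f.2 g.2) h.2⟩ := by
  by_cases hz : p + q = 0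
  · rw [cohomologyLie_cls_eq_zero hz, map_zero, LinearMap.zero_apply, cls_eq_zero]
    rw [tbracket_eq_zero (r := p + q - 1) (by omega), map_zero, LinearMap.zero_apply]
    exact zero_mem _
  · rw [cohomologyLie_cls rfl, cohomologyLie_cls (r := r) (by omega)]

theorem cohomologyLie_lie_right_eq_zero {p q s : ℕ} (hr : p + q + s < 2) (f : cocycles k A p)
    (g : cocycles k A q) (h : cocycles k A s) :
    cohomologyLie k A (cls k A p f) (cohomologyLie k A (cls k A q g) (cls k A s h)) = 0 := by
  by_cases hz : q + s = 0
  · rw [cohomologyLie_cls_eq_zero hz, map_zero]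
  · rw [cohomologyLie_cls rfl, cohomologyLie_cls_eq_zero (by omega)]

theorem cohomologyLie_jacobi {p q : ℕ} (f : cocycles k A p) (g : cocycles k A q)
    (z : ⨁ n, Cohomology k A n) :
    cohomologyLie k A (cls k A p f) (cohomologyLie k A (cls k A q g) z) =
      cohomologyLie k A (cohomologyLie k A (cls k A p f) (cls k A q g)) z +
      (-1 : k) ^ ((p + 1) * (q + 1)) •
        cohomologyLie k A (cls k A q g) (cohomologyLie k A (cls k A p f) z) := by
  induction z using cls_induction with
  | h₀ => simp only [map_zero]; module
  | h₂ z z' hz hz' =>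
    simp only [map_add, hz, hz']
    module
  | h₁ s h =>
  -- An iterated bracket would have negative degree here, and all three terms vanish.
  by_cases hr : p + q + s < 2
  · rw [cohomologyLie_lie_right_eq_zero hr, cohomologyLie_lie_right_eq_zero (by omega)]
    by_cases hz : p + q = 0
    · rw [cohomologyLie_cls_eq_zero hz, map_zero, LinearMap.zero_apply]
      module
    · rw [cohomologyLie_cls rfl, cohomologyLie_cls_eq_zero (by omega)]
      module
  · obtain ⟨r, hr⟩ : ∃ r, p + q + s = r + 2 := ⟨p + q + s - 2, by omega⟩
    rw [cohomologyLie_lie_right hr, cohomologyLie_lie_right (r := r) (by omega),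
      cohomologyLie_lie_left hr, ← cls_smul, ← cls_add]
    exact cls_congr (tbracket_jacobi hr rfl rfl rfl f.1 g.1 h.1) _

theorem cohomologyLie_mul {p q : ℕ} (f : cocycles k A p) (g : cocycles k A q)
    (z : ⨁ n, Cohomology k A n) :
    cohomologyLie k A (cls k A p f) (cohomologyMul k A (cls k A q g) z) =
      cohomologyMul k A (cohomologyLie k A (cls k A p f) (cls k A q g)) z +
      (-1 : k) ^ ((p + 1) * q) •
        cohomologyMul k A (cls k A q g) (cohomologyLie k A (cls k A p f) z) := by
  induction z using cls_induction with
  | h₀ => simp only [map_zero]; module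
  | h₂ z z' hz hz' =>
    simp only [map_add, hz, hz']
    module
  | h₁ s h =>
  rw [cohomologyMul_cls rfl]
  by_cases hr : p + q + s = 0
  · rw [cohomologyLie_cls_eq_zero (by omega), cohomologyLie_cls_eq_zero (by omega),
      cohomologyLie_cls_eq_zero (by omega), map_zero, map_zero, LinearMap.zero_apply]
    module
  obtain ⟨r, hr⟩ : ∃ r, p + q + s = r + 1 := ⟨p + q + s - 1, by omega⟩
  -- The exponent `p + q + 1` has the parity of the degree of [f, g]. For `p + q = 0`, where the
  -- truncated degree has the wrong parity, the bracket is zero.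
  have h₁ : ∃ hc, cohomologyMul k A (cohomologyLie k A (cls k A p f) (cls k A q g)) (cls k A s h) =
      cls k A r ⟨(-1 : k) ^ (p + q + 1) • mulBrace r (tbracket (p + q - 1) f.1 g.1) h.1, hc⟩ := by
    by_cases hz : p + q = 0
    · have e : (-1 : k) ^ (p + q + 1) • mulBrace r (tbracket (p + q - 1) f.1 g.1) h.1 = 0 := by
        rw [tbracket_eq_zero (by omega), map_zero, LinearMap.zero_apply, smul_zero]
      refine ⟨e ▸ zero_mem _, ?_⟩
      rw [cohomologyLie_cls_eq_zero hz, map_zero, LinearMap.zero_apply,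
        cls_eq_zero _ (e ▸ zero_mem _)]
    · have e : (-1 : k) ^ (p + q + 1) = (-1) ^ (p + q - 1) := by
        rw [show p + q + 1 = p + q - 1 + 2 by omega, pow_add _ _ 2, neg_one_sq, mul_one]
      rw [cohomologyLie_cls rfl, cohomologyMul_cls (r := r) (by omega), e]
      exact ⟨_, rfl⟩
  have h₂ : ∃ hc, cohomologyMul k A (cls k A q g) (cohomologyLie k A (cls k A p f) (cls k A s h)) =
      cls k A r ⟨(-1 : k) ^ q • mulBrace r g.1 (tbracket (p + s - 1) f.1 h.1), hc⟩ := by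
    by_cases hz : p + s = 0
    · have e : (-1 : k) ^ q • mulBrace r g.1 (tbracket (p + s - 1) f.1 h.1) = 0 := by
        rw [tbracket_eq_zero (by omega), map_zero, smul_zero]
      refine ⟨e ▸ zero_mem _, ?_⟩
      rw [cohomologyLie_cls_eq_zero hz, map_zero, cls_eq_zero _ (e ▸ zero_mem _)]
    · rw [cohomologyLie_cls rfl, cohomologyMul_cls (r := r) (by omega)]
      exact ⟨_, rfl⟩
  obtain ⟨_, h₁⟩ := h₁
  obtain ⟨_, h₂⟩ := h₂
  rw [h₁, h₂, cohomologyLie_cls (r := r) (by omega), ← cls_smul, ← cls_add]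
  -- The brace needs two inputs of `f`; for `p ≥ 2` no subtraction in its degree is truncated.
  have hb := opDiff_degree_mem (r := r) (brace (p + q - 1 + s - 1) f.1 g.1 h.1) (by
    by_cases hp : p < 2
    · exact Or.inr (brace_eq_zero hp _ _ _)
    · exact Or.inl (by omega))
  refine cls_eq_of_add_mem _ _ (Submodule.smul_mem _ ((-1 : k) ^ (q + (p + 1))) hb) ?_
  have hsign : (-1 : k) ^ (p + q + s + 1) = (-1) ^ r := by
    rw [hr, add_assoc, pow_add, neg_one_sq, mul_one]
  change tbracket r f.1 ((-1 : k) ^ q • mulBrace (q + s) g.1 h.1) =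
    (-1 : k) ^ (p + q + 1) • mulBrace r (tbracket (p + q - 1) f.1 g.1) h.1 +
      (-1 : k) ^ ((p + 1) * q) • (-1 : k) ^ q •
        mulBrace r g.1 (tbracket (p + s - 1) f.1 h.1) + _
  rw [map_smul, tbracket_mulBrace hr rfl rfl rfl rfl f.1 g.1 h.1 (mem_cocycles_iff.1 f.2)
    (mem_cocycles_iff.1 g.2) (mem_cocycles_iff.1 h.2), hsign]
  rcases neg_one_pow_eq_or k p with hp | hp <;> rcases neg_one_pow_eq_or k q with hq | hq <;>
    simp only [pow_mul, pow_add, pow_one, hp, hq, mul_one, mul_neg, neg_neg, one_pow] <;>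
    module

variable (k A) in
/-- The `G`-algebra structure on higher order Hochschild cohomology over `S²`. -/
def cohomologyGAlgebra : GAlgebra k (Cohomology k A) where
  mul := cohomologyMul k A
  lie := cohomologyLie k A
  mul_degree p q r x y h := by
    obtain ⟨f, hf⟩ := exists_cls_eq p x
    obtain ⟨g, hg⟩ := exists_cls_eq q y
    rw [← hf, ← hg, cohomologyMul_cls rfl, cls_apply_of_ne h]
  lie_degree p q r x y h := by
    obtain ⟨f, hf⟩ := exists_cls_eq p x
    obtain ⟨g, hg⟩ := exists_cls_eq q y
    rw [← hf, ← hg]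
    by_cases hz : p + q = 0
    · rw [cohomologyLie_cls_eq_zero hz]
      rfl
    · rw [cohomologyLie_cls rfl, cls_apply_of_ne (by omega)]
  mul_assoc := cohomologyMul_assoc
  mul_comm p q x y := by
    obtain ⟨f, hf⟩ := exists_cls_eq p x
    obtain ⟨g, hg⟩ := exists_cls_eq q y
    rw [← hf, ← hg, cohomologyMul_comm]
  lie_skew p q x y := by
    obtain ⟨f, hf⟩ := exists_cls_eq p x
    obtain ⟨g, hg⟩ := exists_cls_eq q y
    rw [← hf, ← hg, cohomologyLie_skew]
  lie_jacobi p q x y z := by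
    obtain ⟨f, hf⟩ := exists_cls_eq p x
    obtain ⟨g, hg⟩ := exists_cls_eq q y
    rw [← hf, ← hg, cohomologyLie_jacobi]
  lie_mul p q x y z := by
    obtain ⟨f, hf⟩ := exists_cls_eq p x
    obtain ⟨g, hg⟩ := exists_cls_eq q y
    rw [← hf, ← hg, cohomologyLie_mul]

end Cohomology

end HigherHochschildS2

open HigherHochschildS2 in
theorem theorem4p6 (k A : Type*) [Field k] [CommRing A] [Algebra k A] :
    -- the differential of the operad is, up to the sign, that of higher order Hochschild cohomology
    (∀ (n : ℕ) (f : Cochain k A n), delta k A n f = (-1 : k) ^ (n + 1) • opDiff f) ∧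
    (∀ (n : ℕ) (f : Cochain k A n), delta k A (n + 1) (delta k A n f) = 0) ∧
    -- the cup product and the bracket of cochains induce a `G`-algebra structure on cohomology
    ∃ G : GAlgebra k (Cohomology k A),
      (∀ (p q r : ℕ) (h : p + q = r) (f : cocycles k A p) (g : cocycles k A q),
        ∃ hc : cup h f.1 g.1 ∈ cocycles k A r,
          G.mul (cls k A p f) (cls k A q g) = cls k A r ⟨cup h f.1 g.1, hc⟩) ∧
      (∀ (p q r : ℕ) (h : p + q = r + 1) (f : cocycles k A p) (g : cocycles k A q),
        ∃ hb : bracket h f.1 g.1 ∈ cocycles k A r,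
          G.lie (cls k A p f) (cls k A q g) = cls k A r ⟨bracket h f.1 g.1, hb⟩) := by
  refine ⟨delta_eq, delta_delta, cohomologyGAlgebra k A, fun p q r h f g => ?_,
    fun p q r h f g => ?_⟩
  · have e := cohomologyMul_cls h f g
    simp only [cupLinear_eq h] at e
    -- The required membership is read off from the class on the right of `e`.
    exact ⟨_, e⟩
  · have e := cohomologyLie_cls (r := r) (by omega) f g
    simp only [tbracket_eq h] at e
    exact ⟨_, e⟩
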